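/- Let $d\in\{1,2,3\}$, let $c>0$, $\rho_0\ge 0$ and $g,\Omega\in\mathbb R$, and let $D\subset\mathbb R^d$ be a bounded domain (non-empty, open and connected). For $k\in\mathbb C$ with $\operatorname{Re}k>0$ let $G^k$ be the outgoing Green's function of $(-\Delta)^{1/2}-k$ on $\mathbb R^d$, that is, for $x\in\mathbb R^d\setminus\{0\}$, $$ G^k(x)=\begin{cases} \dfrac1{2\pi}\Bigl(e^{ik|x|}E_1(ik|x|)+e^{-ik|x|}E_1(-ik|x|)\Bigr)+i\,e^{ik|x|}, & d=1,\\[2mm] \dfrac1{2\pi|x|}-\dfrac k4\,\mathbf K_0(k|x|)+\dfrac{ik}2\,H^{(1)}_0(k|x|), & d=2,\\[2mm] \dfrac1{2\pi^2|x|^2}-\dfrac{ik}{4\pi^2|x|}\Bigl(e^{ik|x|}E_1(ik|x|)-e^{-ik|x|}E_1(-ik|x|)\Bigr)+\dfrac{k\,e^{ik|x|}}{2\pi|x|}, & d=3, \end{cases} $$ where $E_1(z)=\int_z^\infty t^{-1}e^{-t}\,dt$ is the principal branch of the exponential integral on $\mathbb C\setminus(-\infty,0]$, $H^{(1)}_0=J_0+iY_0$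 is the Hankel function of the first kind of order zero ($J_0,Y_0$ the Bessel functions of the first and second kind), and $\mathbf K_0=\mathbf H_0-Y_0$ is the Struve function of the second kind of order zero ($\mathbf H_0$ the Struve function). For $\omega\in\mathbb C$ with $\operatorname{Re}\omega>0$ and $\phi\in L^2(D)$ put $$ \mathcal G^\omega[\phi](x)=-(\omega-\Omega)\,\phi(x)-\frac{g^2\rho_0}{c}\int_D G^{\omega/c}(x-y)\,\phi(y)\,dy,\qquad x\in D. $$ If $\operatorname{Re}\omega>0$ and there is a non-zero $\psi\in L^2(D)$ with $\mathcal G^\omega[\psi]=0$ almost everywhere in $D$, then $\operatorname{Im}\omega\le 0$. -/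

import Mathlib

open MeasureTheory

namespace QuantumOptics

noncomputable section

/-- The exponential integral `E₁(z) = ∫_z^∞ e^{-t}/t dt` (principal branch, for `z` off the
half-line `(-∞, 0]`). The contour is the horizontal ray `t = z + s`, `s ∈ (0, ∞)`, which does not
meet the branch cut. -/
def expIntegralE1 (z : ℂ) : ℂ :=
  ∫ s in Set.Ioi (0 : ℝ), Complex.exp (-(z + s)) / (z + s)

/-- The Bessel function of the first kind of order zero (Bessel's integral, all complex `z`). -/
def besselJ0 (z : ℂ) : ℂ :=
  1 / (2 * Real.pi) * ∫ θ in (0 : ℝ)..(2 * Real.pi), Complex.exp (Complex.I * z * Real.cos θ)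

/-- The Bessel function of the second kind of order zero (principal branch), for `0 < re z`
(Schläfli's integral). In this half-plane it is the function with the expansion
`(2/π)(log(z/2) + γ) J₀(z) + (2/π) ∑_{n ≥ 1} (-1)^(n+1) (1 + 1/2 + ⋯ + 1/n) (z/2)^(2n) / (n!)²`.
It is only used at `z = k r` with `0 < re k` and `0 < r`. -/
def besselY0 (z : ℂ) : ℂ :=
  1 / Real.pi * (∫ θ in (0 : ℝ)..Real.pi, Complex.sin (z * Real.sin θ))
    - 2 / Real.pi * ∫ t in Set.Ioi (0 : ℝ), Complex.exp (-(z * Real.sinh t))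

/-- The Hankel function of the first kind of order zero, `H₀⁽¹⁾ = J₀ + i Y₀`. -/
def hankelH10 (z : ℂ) : ℂ :=
  besselJ0 z + Complex.I * besselY0 z

/-- The Struve function `𝐇₀` of order zero (Struve's integral, all complex `z`); it equals the sum
of the series `(z/2) ∑_{n ≥ 0} (-1)^n (z/2)^(2n) / Γ(n + 3/2)²`. -/
def struveH0 (z : ℂ) : ℂ :=
  1 / Real.pi * ∫ θ in (0 : ℝ)..Real.pi, Complex.sin (z * Real.sin θ)

/-- The Struve function of the second kind of order zero, `𝐊₀ = 𝐇₀ - Y₀`. -/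
def struveK0 (z : ℂ) : ℂ :=
  struveH0 z - besselY0 z

/-- The radial profile, at distance `r` from the source, of the outgoing Green's function of
`(-Δ)^{1/2} - k` on `ℝ^d`, for `d ∈ {1, 2, 3}` and `0 < re k`. (For other `d` it is a dummy value
that is never used.) -/
def outgoingGreenRadial (d : ℕ) (k : ℂ) (r : ℝ) : ℂ :=
  match d with
  | 1 =>
      1 / (2 * Real.pi) *
          (Complex.exp (Complex.I * k * r) * expIntegralE1 (Complex.I * k * r)
            + Complex.exp (-(Complex.I * k * r)) * expIntegralE1 (-(Complex.I * k * r)))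
        + Complex.I * Complex.exp (Complex.I * k * r)
  | 2 =>
      1 / (2 * Real.pi * r) - k / 4 * struveK0 (k * r) + Complex.I * k / 2 * hankelH10 (k * r)
  | 3 =>
      1 / (2 * Real.pi ^ 2 * r ^ 2)
        - Complex.I * k / (4 * Real.pi ^ 2 * r) *
          (Complex.exp (Complex.I * k * r) * expIntegralE1 (Complex.I * k * r)
            - Complex.exp (-(Complex.I * k * r)) * expIntegralE1 (-(Complex.I * k * r)))
        + k * Complex.exp (Complex.I * k * r) / (2 * Real.pi * r)
  | _ => 0

/-- The outgoing Green's function `G^k` of `(-Δ)^{1/2} - k` on `ℝ^d`. -/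
def outgoingGreen (d : ℕ) (k : ℂ) (x : EuclideanSpace ℝ (Fin d)) : ℂ :=
  outgoingGreenRadial d k ‖x‖

/-- The resonance operator
`𝒢^ω[φ](x) = -(ω - Ω) φ(x) - (g² ρ₀ / c) ∫_D G^{ω/c}(x - y) φ(y) dy`. -/
def resonanceOp (d : ℕ) (c g ρ₀ Ω : ℝ) (D : Set (EuclideanSpace ℝ (Fin d))) (ω : ℂ)
    (φ : EuclideanSpace ℝ (Fin d) → ℂ) (x : EuclideanSpace ℝ (Fin d)) : ℂ :=
  -(ω - Ω) * φ x - (g ^ 2 * ρ₀ / c : ℝ) * ∫ y in D, outgoingGreen d (ω / c) (x - y) * φ y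

end

end QuantumOptics

/-! Suppose `Im ω > 0` and put `k = ω / c`, which then lies in the open first quadrant. There `G^k`
is integrable and is the inverse Fourier transform of `1 / (|ξ| - k)`, whose imaginary part `Im k /
||ξ| - k|²` is nonnegative. Extend `ψ` by zero to `φ`. Testing the resonance equation against `conj
φ` (`resonanceOp_pairing`) gives `(ω - Ω) ‖φ‖² + a Q = 0`, with `a ≥ 0` and `Q` the quadratic form
of `(2π)^d G^k`, that is, `Q = ∫ |φ̂(ξ)|² / (|ξ| - k) dξ`. Hence `Im Q ≥ 0`
(`integral_quadIntegrand_green_im_nonneg`), and the imaginary part of the identity is `Im ω ‖φ‖²`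
plus a nonnegative term, which cannot vanish.

The work lies in linking the explicit special functions to the symbol. Write `1 / (λ - k) = 1 / (λ +
k) + 2k / (λ² - k²)` and express both terms as superpositions of Gaussians `e^{-sλ²}` with complex
times `s` in a sector about the positive axis. The first is a Laplace transform of `e^{-tλ}`,
subordinated to Gaussians; the second is the resolvent of `-Δ + κ²` with `κ = -ik`. On the Fourier
side the superposition sums to the symbol (`integral_poissonWeight_mul`,
`integral_helmholtzWeight_mul`); in space it sums to `E₁`, Struve, Hankel and exponential terms
(`greenSuperposition_eq`). Since Gaussians with times in a fixed sector have uniformly bounded `L¹`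
norms, Fubini carries the quadratic form from one side to the other
(`integral_quadIntegrand_superposition`). -/

namespace QuantumOptics

open Complex ComplexConjugate
open scoped RealInnerProductSpace

noncomputable section

/-! ### Gaussian kernels with complex time. -/

section Gaussian

variable {V : Type*} [NormedAddCommGroup V] [InnerProductSpace ℝ V] [FiniteDimensional ℝ V]
  [MeasurableSpace V] [BorelSpace V]

/-- The (unnormalised) inverse Fourier transform of `ξ ↦ exp (-s ‖ξ‖²)`. -/
def gaussKernel (s : ℂ) (x : V) : ℂ :=
  (Real.pi / s) ^ (Module.finrank ℝ V / 2 : ℂ) * cexp (-(‖x‖ ^ 2 / (4 * s)))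

/-- The Fourier transform `∫ exp (-i ⟪y, ξ⟫) φ(y) dy`. -/
def fourierInt (φ : V → ℂ) (ξ : V) : ℂ :=
  ∫ y, cexp (-(I * ⟪y, ξ⟫)) * φ y

theorem integral_cexp_eq_gaussKernel {s : ℂ} (hs : 0 < s.re) (x : V) :
    ∫ ξ : V, cexp (-s * ‖ξ‖ ^ 2 + I * ⟪x, ξ⟫) = gaussKernel s x := by
  rw [GaussianFourier.integral_cexp_neg_mul_sq_norm_add hs I x, gaussKernel, I_sq]
  congr 2
  ring

omit [FiniteDimensional ℝ V] [MeasurableSpace V] [BorelSpace V] in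
theorem norm_gaussKernel {s : ℂ} (hs : 0 < s.re) (x : V) :
    ‖gaussKernel s x‖ = (Real.pi / ‖s‖) ^ (Module.finrank ℝ V / 2 : ℝ) *
      Real.exp (-(s.re / (4 * ‖s‖ ^ 2)) * ‖x‖ ^ 2) := by
  have hs0 : s ≠ 0 := by rintro rfl; simp at hs
  have h1 : (Module.finrank ℝ V / 2 : ℂ) = ((Module.finrank ℝ V / 2 : ℝ) : ℂ) := by push_cast; rfl
  rw [gaussKernel, norm_mul, h1, norm_cpow_real, norm_div, norm_exp]
  congr 2
  · rw [norm_real, Real.norm_of_nonneg Real.pi_pos.le]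
  · have : -((‖x‖ : ℂ) ^ 2 / (4 * s)) = ((‖x‖ ^ 2 / 4 : ℝ) : ℂ) * -(s⁻¹) := by
      push_cast; field_simp
    rw [this, re_ofReal_mul, neg_re, inv_re, normSq_eq_norm_sq]
    have : ‖s‖ ≠ 0 := norm_ne_zero_iff.mpr hs0
    field_simp

theorem integrable_gaussKernel {s : ℂ} (hs : 0 < s.re) :
    Integrable (gaussKernel s : V → ℂ) := by
  have hs0 : s ≠ 0 := by rintro rfl; simp at hs
  have hb : 0 < (1 / (4 * s)).re := by
    rw [one_div, inv_re]
    have : 0 < normSq (4 * s) := by simp [normSq_pos, hs0]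
    have : (4 * s).re = 4 * s.re := by simp
    rw [this]; positivity
  have := (GaussianFourier.integrable_cexp_neg_mul_sq_norm_add hb 0 (0 : V)).const_mul
    ((Real.pi / s) ^ (Module.finrank ℝ V / 2 : ℂ))
  refine this.congr (.of_forall fun x ↦ ?_)
  simp only [gaussKernel]
  congr 2
  ring

/-- The `L¹` norm is `(4π² ‖s‖ / Re s)^(n/2)`, a function of the argument of `s` alone. This
uniformity over a sector makes superpositions of Gaussians converge absolutely. -/
theorem integral_norm_gaussKernel_le {s : ℂ} (hs : 0 < s.re) {C : ℝ} (hC : ‖s‖ ≤ C * s.re) :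
    ∫ x : V, ‖gaussKernel s x‖ ≤ (4 * Real.pi ^ 2 * C) ^ (Module.finrank ℝ V / 2 : ℝ) := by
  have hs0 : s ≠ 0 := by rintro rfl; simp at hs
  have hn : 0 < ‖s‖ := norm_pos_iff.mpr hs0
  simp_rw [norm_gaussKernel hs]
  rw [integral_const_mul, GaussianFourier.integral_rexp_neg_mul_sq_norm (by positivity),
    ← Real.mul_rpow (by positivity) (by positivity)]
  refine Real.rpow_le_rpow (by positivity) ?_ (by positivity)
  have : Real.pi / ‖s‖ * (Real.pi / (s.re / (4 * ‖s‖ ^ 2))) = 4 * Real.pi ^ 2 * (‖s‖ / s.re) := by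
    field_simp
  rw [this]
  gcongr
  rwa [div_le_iff₀ hs]

/-! ### Quadratic forms of convolution kernels, and their Fourier side for Gaussians. -/

section Quadratic

variable {k φ : V → ℂ}

theorem integrable_norm_kernel_mul_sq (hk : Integrable k) (hφ : MemLp φ 2) :
    Integrable (fun p : V × V ↦ ‖k (p.1 - p.2)‖ * ‖φ p.2‖ ^ 2) (volume.prod volume) := by
  have := hφ.integrable_norm_pow (p := 2) (by norm_num)
  simpa [mul_comm] using Integrable.convolution_integrand (ContinuousLinearMap.mul ℝ ℝ) this hk.norm

theorem integrable_norm_kernel_mul_sq' (hk : Integrable k) (hφ : MemLp φ 2) :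
    Integrable (fun p : V × V ↦ ‖k (p.1 - p.2)‖ * ‖φ p.1‖ ^ 2) (volume.prod volume) := by
  have := (integrable_norm_kernel_mul_sq hk.comp_neg hφ).swap
  refine this.congr (.of_forall fun p ↦ ?_)
  simp

theorem integral_norm_kernel_mul_sq (hk : Integrable k) (hφ : MemLp φ 2) :
    ∫ p : V × V, ‖k (p.1 - p.2)‖ * ‖φ p.2‖ ^ 2 ∂(volume.prod volume) =
      (∫ x, ‖k x‖) * ∫ x, ‖φ x‖ ^ 2 := by
  rw [integral_prod_symm _ (integrable_norm_kernel_mul_sq hk hφ)]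
  simp_rw [integral_mul_const]
  rw [← integral_const_mul]
  congr with y
  rw [integral_sub_right_eq_self (fun x ↦ ‖k x‖) y]

theorem integral_norm_kernel_mul_sq' (hk : Integrable k) (hφ : MemLp φ 2) :
    ∫ p : V × V, ‖k (p.1 - p.2)‖ * ‖φ p.1‖ ^ 2 ∂(volume.prod volume) =
      (∫ x, ‖k x‖) * ∫ x, ‖φ x‖ ^ 2 := by
  rw [integral_prod _ (integrable_norm_kernel_mul_sq' hk hφ)]
  simp_rw [integral_mul_const]
  rw [← integral_const_mul]
  congr with x
  rw [integral_sub_left_eq_self (fun x ↦ ‖k x‖) volume x]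

/-- The integrand `k (x - y) φ(y) conj φ(x)` of the quadratic form of the convolution kernel `k`. -/
def quadIntegrand (k φ : V → ℂ) (p : V × V) : ℂ :=
  k (p.1 - p.2) * φ p.2 * conj (φ p.1)

omit [InnerProductSpace ℝ V] [FiniteDimensional ℝ V] [MeasurableSpace V] [BorelSpace V] in
-- The inequality `2ab ≤ a² + b²`. Each of the two resulting terms integrates to `‖k‖₁ ‖φ‖₂²`, so no
-- Young inequality for convolutions is needed.
theorem norm_quadIntegrand_le (k φ : V → ℂ) (p : V × V) :
    ‖quadIntegrand k φ p‖ ≤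
      (‖k (p.1 - p.2)‖ * ‖φ p.2‖ ^ 2 + ‖k (p.1 - p.2)‖ * ‖φ p.1‖ ^ 2) / 2 := by
  rw [quadIntegrand, norm_mul, norm_mul, RCLike.norm_conj]
  nlinarith [norm_nonneg (k (p.1 - p.2)),
    mul_nonneg (norm_nonneg (k (p.1 - p.2))) (sq_nonneg (‖φ p.2‖ - ‖φ p.1‖))]

theorem integrable_quadIntegrand (hk : Integrable k) (hφ : MemLp φ 2) :
    Integrable (quadIntegrand k φ) (volume.prod volume) := by
  refine (((integrable_norm_kernel_mul_sq hk hφ).add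
    (integrable_norm_kernel_mul_sq' hk hφ)).div_const 2).mono' ?_
    (.of_forall (norm_quadIntegrand_le k φ))
  have h1 : AEStronglyMeasurable (fun p : V × V ↦ k (p.1 - p.2)) (volume.prod volume) :=
    hk.aestronglyMeasurable.comp_quasiMeasurePreserving
      (quasiMeasurePreserving_sub_of_right_invariant volume volume)
  have h2 : AEStronglyMeasurable (fun p : V × V ↦ conj (φ p.1)) (volume.prod volume) :=
    continuous_conj.comp_aestronglyMeasurable hφ.aestronglyMeasurable.comp_fst
  exact (h1.mul hφ.aestronglyMeasurable.comp_snd).mul h2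

theorem integral_norm_quadIntegrand_le (hk : Integrable k) (hφ : MemLp φ 2) :
    ∫ p, ‖quadIntegrand k φ p‖ ∂(volume.prod volume) ≤ (∫ x, ‖k x‖) * ∫ x, ‖φ x‖ ^ 2 := by
  have h1 := integrable_norm_kernel_mul_sq hk hφ
  have h2 := integrable_norm_kernel_mul_sq' hk hφ
  refine (integral_mono (integrable_quadIntegrand hk hφ).norm ((h1.add h2).div_const 2)
    (norm_quadIntegrand_le k φ)).trans_eq ?_
  rw [integral_div]
  simp only [Pi.add_apply]
  rw [integral_add h1 h2, integral_norm_kernel_mul_sq hk hφ, integral_norm_kernel_mul_sq' hk hφ]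
  ring

/-- Licenses the exchange of `ξ` with `(x, y)`: the oscillating factor has modulus one, which leaves
a product of integrable functions of `x`, `y` and `ξ`. -/
theorem integrable_fourier_sq {s : ℂ} (hs : 0 < s.re) (hφ : Integrable φ) :
    Integrable (fun q : (V × V) × V ↦
      cexp (-s * ‖q.2‖ ^ 2 + I * ⟪q.1.1 - q.1.2, q.2⟫) * (φ q.1.2 * conj (φ q.1.1)))
      ((volume.prod volume).prod volume) := by
  have hc : Integrable (fun x ↦ conj (φ x)) :=
    ⟨continuous_conj.comp_aestronglyMeasurable hφ.aestronglyMeasurable, by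
      simpa [HasFiniteIntegral, enorm] using hφ.2⟩
  have h1 := (hc.mul_prod hφ).mul_prod
    (GaussianFourier.integrable_cexp_neg_mul_sq_norm_add hs 0 (0 : V))
  refine h1.mono ?_ (.of_forall fun q ↦ ?_)
  · have h2 : Continuous (fun q : (V × V) × V ↦
      cexp (-s * ‖q.2‖ ^ 2 + I * ⟪q.1.1 - q.1.2, q.2⟫)) := by fun_prop
    have h3 := (hc.mul_prod hφ).aestronglyMeasurable.comp_fst (ν := (volume : Measure V))
    refine (h2.aestronglyMeasurable.mul h3).congr (.of_forall fun q ↦ ?_)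
    simp [mul_comm]
  · simp only [norm_mul, norm_exp]
    refine le_of_eq ?_
    simp only [add_re, mul_re, I_re, I_im, ofReal_re, ofReal_im]
    simp
    ring

/-- The phase `e^{i⟪x - y, ξ⟫}` splits, so the double integral is the product of the Fourier
integral and its conjugate. -/
theorem integral_fourier_factor (s : ℂ) (φ : V → ℂ) (ξ : V) :
    ∫ p : V × V, cexp (-s * ‖ξ‖ ^ 2 + I * ⟪p.1 - p.2, ξ⟫) * (φ p.2 * conj (φ p.1))
      ∂(volume.prod volume) = cexp (-s * ‖ξ‖ ^ 2) * ‖fourierInt φ ξ‖ ^ 2 := by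
  have : ∀ p : V × V, cexp (-s * ‖ξ‖ ^ 2 + I * ⟪p.1 - p.2, ξ⟫) * (φ p.2 * conj (φ p.1)) =
      cexp (-s * ‖ξ‖ ^ 2) * (conj (cexp (-(I * ⟪p.1, ξ⟫)) * φ p.1) *
        (cexp (-(I * ⟪p.2, ξ⟫)) * φ p.2)) := by
    intro p
    rw [map_mul, ← exp_conj, exp_add, inner_sub_left, ofReal_sub, mul_sub, sub_eq_add_neg,
      exp_add]
    simp
    ring
  simp_rw [this]
  rw [integral_const_mul, integral_prod_mul (fun x ↦ conj (cexp (-(I * ⟪x, ξ⟫)) * φ x))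
    (fun y ↦ cexp (-(I * ⟪y, ξ⟫)) * φ y), integral_conj, ← fourierInt, conj_mul']

theorem integrable_gauss_mul_fourierInt_sq {s : ℂ} (hs : 0 < s.re) (hφ : Integrable φ) :
    Integrable (fun ξ ↦ cexp (-s * ‖ξ‖ ^ 2) * ‖fourierInt φ ξ‖ ^ 2) :=
  (integrable_fourier_sq hs hφ).integral_prod_right.congr
    (.of_forall fun ξ ↦ integral_fourier_factor s φ ξ)

/-- The quadratic form of a Gaussian kernel on the Fourier side. -/
theorem integral_quadIntegrand_gaussKernel {s : ℂ} (hs : 0 < s.re) (hφ : Integrable φ) :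
    ∫ p, quadIntegrand (gaussKernel s) φ p ∂(volume.prod volume) =
      ∫ ξ, cexp (-s * ‖ξ‖ ^ 2) * ‖fourierInt φ ξ‖ ^ 2 := by
  have h := integral_integral_swap (f := fun (p : V × V) (ξ : V) ↦
    cexp (-s * ‖ξ‖ ^ 2 + I * ⟪p.1 - p.2, ξ⟫) * (φ p.2 * conj (φ p.1)))
    (integrable_fourier_sq hs hφ)
  simp_rw [integral_mul_const, integral_cexp_eq_gaussKernel hs, integral_fourier_factor] at h
  rw [← h]
  congr with p
  rw [quadIntegrand, mul_assoc]

theorem aestronglyMeasurable_fourierInt_sq (hφ : Integrable φ) :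
    AEStronglyMeasurable (fun ξ ↦ (‖fourierInt φ ξ‖ ^ 2 : ℂ)) := by
  -- Measurability comes from Fubini for the Gaussian-weighted function; the weight with `s = 1` is
  -- then divided out.
  have h1 := (integrable_gauss_mul_fourierInt_sq (s := 1) (by simp) hφ).aestronglyMeasurable
  have h2 : Continuous (fun ξ : V ↦ cexp (1 * ‖ξ‖ ^ 2)) := by fun_prop
  refine (h2.aestronglyMeasurable.mul h1).congr (.of_forall fun ξ ↦ ?_)
  simp only [Pi.mul_apply, ← mul_assoc, ← exp_add]
  simp

/-- Stands in for Plancherel. Taking absolute values replaces `s` by `Re s`; for a real time the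
integral is itself a Gaussian quadratic form, and the sector constant is `1`, so the bound does not
depend on `s`. -/
theorem integral_norm_gauss_mul_fourierInt_sq_le {s : ℂ} (hs : 0 < s.re) (hφ : Integrable φ)
    (hφ2 : MemLp φ 2) :
    ∫ ξ, ‖cexp (-s * ‖ξ‖ ^ 2) * ‖fourierInt φ ξ‖ ^ 2‖ ≤
      (4 * Real.pi ^ 2) ^ (Module.finrank ℝ V / 2 : ℝ) * ∫ x, ‖φ x‖ ^ 2 := by
  have hσ : 0 < (s.re : ℂ).re := by simpa using hs
  have h1 : ∀ ξ : V, ‖cexp (-s * ‖ξ‖ ^ 2) * ‖fourierInt φ ξ‖ ^ 2‖ =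
      (cexp (-(s.re : ℂ) * ‖ξ‖ ^ 2) * ‖fourierInt φ ξ‖ ^ 2).re := by
    intro ξ
    have : cexp (-(s.re : ℂ) * ‖ξ‖ ^ 2) * ‖fourierInt φ ξ‖ ^ 2 =
        ((Real.exp (-s.re * ‖ξ‖ ^ 2) * ‖fourierInt φ ξ‖ ^ 2 : ℝ) : ℂ) := by push_cast; rfl
    rw [this, ofReal_re, norm_mul, norm_exp]
    congr 1
    · rw [← ofReal_pow, re_mul_ofReal, neg_re]
    · simp
  simp_rw [h1]
  calc _ = (∫ p, quadIntegrand (gaussKernel (s.re : ℂ)) φ p ∂(volume.prod volume)).re := by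
        rw [integral_quadIntegrand_gaussKernel hσ hφ]
        exact integral_re (𝕜 := ℂ) (integrable_gauss_mul_fourierInt_sq hσ hφ)
    _ ≤ _ := re_le_norm _
    _ ≤ _ := norm_integral_le_integral_norm _
    _ ≤ _ := integral_norm_quadIntegrand_le (integrable_gaussKernel hσ) hφ2
    _ ≤ _ := by
      gcongr
      simpa using integral_norm_gaussKernel_le (V := V) hσ (C := 1)
        (by rw [norm_real, ofReal_re, Real.norm_of_nonneg hs.le, one_mul])

end Quadratic

/-! ### Superpositions of Gaussian kernels with times in a sector. -/

section Superposition

variable {A : Type*} [MeasurableSpace A] {μ : Measure A} [SFinite μ] {m s : A → ℂ} {C : ℝ}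

omit [FiniteDimensional ℝ V] in
theorem measurable_gaussKernel_uncurry (hs : Measurable s) :
    Measurable (fun q : A × V ↦ gaussKernel (s q.1) q.2) := by
  unfold gaussKernel
  fun_prop

omit [SFinite μ] in
theorem integrable_superposition (hm : Integrable m μ) (hs : Measurable s)
    (hs0 : ∀ᵐ α ∂μ, 0 < (s α).re) (hC : ∀ᵐ α ∂μ, ‖s α‖ ≤ C * (s α).re) :
    Integrable (fun q : A × V ↦ m q.1 * gaussKernel (s q.1) q.2) (μ.prod volume) := by
  have hmeas : AEStronglyMeasurable (fun q : A × V ↦ m q.1 * gaussKernel (s q.1) q.2)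
      (μ.prod volume) :=
    hm.aestronglyMeasurable.comp_fst.mul (measurable_gaussKernel_uncurry hs).aestronglyMeasurable
  rw [integrable_prod_iff hmeas]
  refine ⟨?_, ?_⟩
  · filter_upwards [hs0] with α h0
    exact (integrable_gaussKernel h0).const_mul _
  · refine (hm.norm.mul_const ((4 * Real.pi ^ 2 * C) ^ (Module.finrank ℝ V / 2 : ℝ))).mono'
      hmeas.norm.integral_prod_right' ?_
    filter_upwards [hs0, hC] with α h0 h1
    simp_rw [norm_mul]
    rw [integral_const_mul, norm_mul, norm_norm, Real.norm_of_nonneg (by positivity)]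
    gcongr
    exact integral_norm_gaussKernel_le h0 h1

omit [SFinite μ] in
theorem integrable_superposition_fourier {φ : V → ℂ} (hm : Integrable m μ) (hs : Measurable s)
    (hs0 : ∀ᵐ α ∂μ, 0 < (s α).re) (hφ : Integrable φ) (hφ2 : MemLp φ 2) :
    Integrable (fun q : A × V ↦ m q.1 * (cexp (-s q.1 * ‖q.2‖ ^ 2) * ‖fourierInt φ q.2‖ ^ 2))
      (μ.prod volume) := by
  have h2 : Measurable (fun q : A × V ↦ cexp (-s q.1 * ‖q.2‖ ^ 2)) := by fun_prop
  have hmeas : AEStronglyMeasurable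
      (fun q : A × V ↦ m q.1 * (cexp (-s q.1 * ‖q.2‖ ^ 2) * ‖fourierInt φ q.2‖ ^ 2))
      (μ.prod volume) :=
    hm.aestronglyMeasurable.comp_fst.mul
      (h2.aestronglyMeasurable.mul (aestronglyMeasurable_fourierInt_sq hφ).comp_snd)
  rw [integrable_prod_iff hmeas]
  refine ⟨?_, ?_⟩
  · filter_upwards [hs0] with α h0
    exact (integrable_gauss_mul_fourierInt_sq h0 hφ).const_mul _
  · refine (hm.norm.mul_const ((4 * Real.pi ^ 2) ^ (Module.finrank ℝ V / 2 : ℝ) *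
      ∫ x, ‖φ x‖ ^ 2)).mono' hmeas.norm.integral_prod_right' ?_
    filter_upwards [hs0] with α h0
    simp only [norm_mul (m _)]
    rw [integral_const_mul, norm_mul, norm_norm,
      Real.norm_of_nonneg (integral_nonneg fun _ ↦ norm_nonneg _)]
    gcongr
    exact integral_norm_gauss_mul_fourierInt_sq_le h0 hφ hφ2

omit [SFinite μ] in
theorem aestronglyMeasurable_superposition_quadIntegrand {φ : V → ℂ} (hm : Integrable m μ)
    (hs : Measurable s) (hφ : AEStronglyMeasurable φ) :
    AEStronglyMeasurable (fun q : A × (V × V) ↦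
      m q.1 * quadIntegrand (gaussKernel (s q.1)) φ q.2) (μ.prod (volume.prod volume)) := by
  have h1 : Measurable (fun q : A × (V × V) ↦ gaussKernel (s q.1) (q.2.1 - q.2.2)) := by
    unfold gaussKernel
    fun_prop
  have h2 : AEStronglyMeasurable (fun p : V × V ↦ φ p.2 * conj (φ p.1)) (volume.prod volume) :=
    hφ.comp_snd.mul (continuous_conj.comp_aestronglyMeasurable hφ.comp_fst)
  have h3 : AEStronglyMeasurable (fun q : A × (V × V) ↦ φ q.2.2 * conj (φ q.2.1))
      (μ.prod (volume.prod volume)) := h2.comp_snd (μ := μ)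
  have h4 : AEStronglyMeasurable (fun q : A × (V × V) ↦ m q.1) (μ.prod (volume.prod volume)) :=
    hm.aestronglyMeasurable.comp_fst
  refine (h4.mul (h1.aestronglyMeasurable.mul h3)).congr (.of_forall fun q ↦ ?_)
  simp only [Pi.mul_apply, quadIntegrand, mul_assoc]

omit [SFinite μ] in
theorem integrable_superposition_quadIntegrand {φ : V → ℂ} (hm : Integrable m μ)
    (hs : Measurable s) (hs0 : ∀ᵐ α ∂μ, 0 < (s α).re) (hC : ∀ᵐ α ∂μ, ‖s α‖ ≤ C * (s α).re)
    (hφ2 : MemLp φ 2) :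
    Integrable (fun q : A × (V × V) ↦ m q.1 * quadIntegrand (gaussKernel (s q.1)) φ q.2)
      (μ.prod (volume.prod volume)) := by
  have hmeas := aestronglyMeasurable_superposition_quadIntegrand hm hs hφ2.aestronglyMeasurable
  rw [integrable_prod_iff hmeas]
  refine ⟨?_, ?_⟩
  · filter_upwards [hs0] with α h0
    exact (integrable_quadIntegrand (integrable_gaussKernel h0) hφ2).const_mul _
  · refine (hm.norm.mul_const ((4 * Real.pi ^ 2 * C) ^ (Module.finrank ℝ V / 2 : ℝ) *
      ∫ x, ‖φ x‖ ^ 2)).mono' hmeas.norm.integral_prod_right' ?_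
    filter_upwards [hs0, hC] with α h0 h1
    simp only [norm_mul (m _)]
    rw [integral_const_mul, norm_mul, norm_norm,
      Real.norm_of_nonneg (integral_nonneg fun _ ↦ norm_nonneg _)]
    gcongr
    refine (integral_norm_quadIntegrand_le (integrable_gaussKernel h0) hφ2).trans ?_
    gcongr
    exact integral_norm_gaussKernel_le h0 h1

/-- The quadratic form of a superposition of Gaussian kernels on the Fourier side. -/
theorem integral_quadIntegrand_superposition {φ : V → ℂ} (hm : Integrable m μ) (hs : Measurable s)
    (hs0 : ∀ᵐ α ∂μ, 0 < (s α).re) (hC : ∀ᵐ α ∂μ, ‖s α‖ ≤ C * (s α).re)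
    (hφ : Integrable φ) (hφ2 : MemLp φ 2) :
    ∫ p, quadIntegrand (fun x ↦ ∫ α, m α * gaussKernel (s α) x ∂μ) φ p ∂(volume.prod volume) =
      ∫ ξ, (∫ α, m α * cexp (-s α * ‖ξ‖ ^ 2) ∂μ) * ‖fourierInt φ ξ‖ ^ 2 := by
  have hfub := integrable_superposition_quadIntegrand hm hs hs0 hC hφ2
  have hfub' := integrable_superposition_fourier (V := V) hm hs hs0 hφ hφ2
  calc _ = ∫ p, ∫ α, m α * quadIntegrand (gaussKernel (s α)) φ p ∂μ ∂(volume.prod volume) := by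
        congr with p
        simp only [quadIntegrand, ← integral_mul_const]
        congr with α
        ring
    _ = ∫ α, ∫ p, m α * quadIntegrand (gaussKernel (s α)) φ p ∂(volume.prod volume) ∂μ :=
        (integral_integral_swap hfub).symm
    _ = ∫ α, ∫ ξ, m α * (cexp (-s α * ‖ξ‖ ^ 2) * ‖fourierInt φ ξ‖ ^ 2) ∂volume ∂μ := by
        refine integral_congr_ae ?_
        filter_upwards [hs0] with α h0
        rw [integral_const_mul, integral_const_mul, integral_quadIntegrand_gaussKernel h0 hφ]
    _ = ∫ ξ : V, ∫ α, m α * (cexp (-s α * ‖ξ‖ ^ 2) * ‖fourierInt φ ξ‖ ^ 2) ∂μ :=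
        integral_integral_swap hfub'
    _ = _ := by
        congr with ξ
        simp only [← mul_assoc, integral_mul_const]

end Superposition
end Gaussian

/-! ### Changes of variable and Macdonald integrals of order one half. -/

section ScalarIntegrals

theorem ofReal_mul_cpow {r : ℝ} (hr : 0 < r) {z : ℂ} (hz : z ≠ 0) (p : ℂ) :
    ((r : ℂ) * z) ^ p = (r : ℂ) ^ p * z ^ p := by
  have hr' : (r : ℂ) ≠ 0 := by exact_mod_cast hr.ne'
  rw [cpow_def_of_ne_zero (mul_ne_zero hr' hz), cpow_def_of_ne_zero hr', cpow_def_of_ne_zero hz,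
    log_ofReal_mul hr hz, ← exp_add, ofReal_log hr.le]
  ring_nf

theorem ofReal_exp_cpow (t : ℝ) (p : ℂ) : ((Real.exp t : ℝ) : ℂ) ^ p = cexp (t * p) := by
  have h : ((Real.exp t : ℝ) : ℂ) ≠ 0 := by exact_mod_cast (Real.exp_pos t).ne'
  rw [cpow_def_of_ne_zero h, ← ofReal_log (Real.exp_pos t).le, Real.log_exp]

/-- As `a * b` is positive, `a` and `b` have opposite arguments, and `a` is off the branch cut; the
phases of the principal roots cancel. -/
theorem cpow_half_mul_cpow_half {a b : ℂ} {c : ℝ} (hc : 0 < c) (ha : 0 < a.re)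
    (hab : a * b = c ^ 2) : a ^ (1 / 2 : ℂ) * b ^ (1 / 2 : ℂ) = c := by
  have ha0 : a ≠ 0 := by rintro rfl; simp at ha
  have hc' : (c : ℂ) ≠ 0 := by exact_mod_cast hc.ne'
  have hb : b = ((c ^ 2 : ℝ) : ℂ) * a⁻¹ := by
    rw [ofReal_pow, ← hab]; field_simp
  have harg : a.arg ≠ Real.pi := by
    intro h
    rw [arg_eq_pi_iff] at h
    linarith [h.1]
  have hc2 : ((c ^ 2 : ℝ) : ℂ) ^ (1 / 2 : ℂ) = c := by
    have : ((c ^ 2 : ℝ) : ℂ) ^ ((1 / 2 : ℝ) : ℂ) = ((c ^ 2) ^ (1 / 2 : ℝ) : ℝ) :=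
      (ofReal_cpow (by positivity) _).symm
    rw [← Real.sqrt_eq_rpow, Real.sqrt_sq hc.le] at this
    rw [← this]
    norm_num
  rw [hb, ofReal_mul_cpow (by positivity) (inv_ne_zero ha0), hc2, inv_cpow _ _ harg]
  have : a ^ (1 / 2 : ℂ) ≠ 0 := by simp [cpow_eq_zero_iff, ha0]
  field_simp

theorem integral_comp_of_bijective {f f' : ℝ → ℝ} (hf : ∀ x, HasDerivAt f (f' x) x)
    (hb : Function.Bijective f) (g : ℝ → ℂ) : ∫ x, |f' x| • g (f x) = ∫ y, g y := by
  have h := integral_image_eq_integral_abs_deriv_smul MeasurableSet.univ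
    (fun x _ ↦ (hf x).hasDerivWithinAt) hb.1.injOn g
  rw [Set.image_univ, hb.2.range_eq, setIntegral_univ, setIntegral_univ] at h
  exact h.symm

theorem integrable_comp_of_bijective {f f' : ℝ → ℝ} (hf : ∀ x, HasDerivAt f (f' x) x)
    (hb : Function.Bijective f) {g : ℝ → ℂ} (hg : Integrable g) :
    Integrable (fun x ↦ |f' x| • g (f x)) := by
  have h := integrableOn_image_iff_integrableOn_abs_deriv_smul MeasurableSet.univ
    (fun x _ ↦ (hf x).hasDerivWithinAt) hb.1.injOn g
  rw [Set.image_univ, hb.2.range_eq, integrableOn_univ, integrableOn_univ] at h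
  exact h.1 hg

theorem integral_comp_exp (g : ℝ → ℂ) :
    ∫ x, Real.exp x • g (Real.exp x) = ∫ y in Set.Ioi 0, g y := by
  have h := integral_image_eq_integral_abs_deriv_smul MeasurableSet.univ
    (fun x _ ↦ (Real.hasDerivAt_exp x).hasDerivWithinAt) Real.exp_injective.injOn g
  rw [Set.image_univ, Real.range_exp, setIntegral_univ] at h
  simpa using h.symm

theorem integrable_comp_exp_iff {g : ℝ → ℂ} :
    Integrable (fun x ↦ Real.exp x • g (Real.exp x)) ↔ IntegrableOn g (Set.Ioi 0) := by
  have h := integrableOn_image_iff_integrableOn_abs_deriv_smul MeasurableSet.univ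
    (fun x _ ↦ (Real.hasDerivAt_exp x).hasDerivWithinAt) Real.exp_injective.injOn g
  rw [Set.image_univ, Real.range_exp, integrableOn_univ] at h
  simpa using h.symm

theorem hasDerivAt_sinh_half (w : ℝ) :
    HasDerivAt (fun w ↦ Real.sinh (w / 2)) (Real.cosh (w / 2) / 2) w := by
  simpa [div_eq_mul_inv] using ((hasDerivAt_id w).div_const 2).sinh

theorem bijective_sinh_half : Function.Bijective (fun w : ℝ ↦ Real.sinh (w / 2)) :=
  ⟨fun a b h ↦ by have := Real.sinh_injective h; linarith,
    fun y ↦ ⟨2 * Real.arsinh y, by simp⟩⟩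

theorem cosh_eq_one_add_two_sinh_half (w : ℝ) :
    Real.cosh w = 1 + 2 * Real.sinh (w / 2) ^ 2 := by
  have h := Real.cosh_two_mul (w / 2)
  rw [Real.cosh_sq, show 2 * (w / 2) = w by ring] at h
  linarith

variable {z : ℂ}

/-- With `y = sinh (w / 2)` one has `cosh w = 1 + 2y²`, and the factor `cosh (w / 2)` is twice the
Jacobian: the integral becomes a Gaussian one with parameter `2z`. -/
theorem integrable_cosh_half_mul_exp (hz : 0 < z.re) :
    Integrable (fun w : ℝ ↦ (Real.cosh (w / 2) : ℂ) * cexp (-(z * Real.cosh w))) := by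
  have hg := (integrable_cexp_neg_mul_sq (b := 2 * z) (by simpa using hz)).const_mul (2 * cexp (-z))
  refine (integrable_comp_of_bijective hasDerivAt_sinh_half bijective_sinh_half hg).congr
    (.of_forall fun w ↦ ?_)
  simp only
  rw [abs_of_pos (by positivity), cosh_eq_one_add_two_sinh_half w, mul_assoc 2, ← exp_add, real_smul]
  push_cast
  rw [show -z + -(2 * z) * Complex.sinh (w / 2) ^ 2 = -(z * (1 + 2 * Complex.sinh (w / 2) ^ 2)) by
    ring]
  ring

theorem integral_cosh_half_mul_exp (hz : 0 < z.re) :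
    ∫ w : ℝ, (Real.cosh (w / 2) : ℂ) * cexp (-(z * Real.cosh w)) =
      2 * (Real.pi / (2 * z)) ^ (1 / 2 : ℂ) * cexp (-z) := by
  have h := integral_comp_of_bijective hasDerivAt_sinh_half bijective_sinh_half
    (fun y ↦ 2 * cexp (-z) * cexp (-(2 * z) * y ^ 2))
  rw [integral_const_mul, integral_gaussian_complex (by simpa using hz)] at h
  rw [mul_right_comm, ← h]
  congr with w
  rw [abs_of_pos (by positivity), cosh_eq_one_add_two_sinh_half w, mul_assoc 2, ← exp_add, real_smul]
  push_cast
  rw [show -z + -(2 * z) * Complex.sinh (w / 2) ^ 2 = -(z * (1 + 2 * Complex.sinh (w / 2) ^ 2)) by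
    ring]
  ring

theorem integrable_exp_half_mul_exp (hz : 0 < z.re) :
    Integrable (fun w : ℝ ↦ cexp (w / 2) * cexp (-(z * Real.cosh w))) := by
  refine ((integrable_cosh_half_mul_exp hz).const_mul 2).mono (by fun_prop)
    (.of_forall fun w ↦ ?_)
  rw [norm_mul, norm_mul, norm_mul, ← mul_assoc]
  gcongr
  rw [norm_real, Real.norm_of_nonneg (Real.cosh_pos _).le, norm_exp, Real.cosh_eq]
  have : ((w : ℂ) / 2).re = w / 2 := by simp
  rw [this]
  norm_num
  nlinarith [Real.exp_pos (-(w / 2))]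

/-- The Macdonald function of order `1/2`. -/
theorem integral_exp_half_mul_exp (hz : 0 < z.re) :
    ∫ w : ℝ, cexp (w / 2) * cexp (-(z * Real.cosh w)) =
      2 * (Real.pi / (2 * z)) ^ (1 / 2 : ℂ) * cexp (-z) := by
  rw [← integral_cosh_half_mul_exp hz]
  have h1 := integral_neg_eq_self (fun w : ℝ ↦ cexp (w / 2) * cexp (-(z * Real.cosh w))) volume
  have h2 := (integrable_exp_half_mul_exp hz).comp_neg
  have h3 : ∀ w : ℝ, (Real.cosh (w / 2) : ℂ) * cexp (-(z * Real.cosh w)) =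
      (cexp (w / 2) * cexp (-(z * Real.cosh w)) +
        cexp ((-w : ℝ) / 2) * cexp (-(z * Real.cosh (-w)))) / 2 := by
    intro w
    rw [Real.cosh_neg, Real.cosh_eq (w / 2)]
    push_cast
    ring_nf
  simp_rw [h3]
  rw [integral_div, integral_add (integrable_exp_half_mul_exp hz) h2, h1]
  ring

theorem integral_exp_neg_half_mul_exp (hz : 0 < z.re) :
    ∫ w : ℝ, cexp (-w / 2) * cexp (-(z * Real.cosh w)) =
      2 * (Real.pi / (2 * z)) ^ (1 / 2 : ℂ) * cexp (-z) := by
  rw [← integral_exp_half_mul_exp hz, ← integral_neg_eq_self _ volume]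
  simp

theorem integrableOn_exp_neg_mul (hz : 0 < z.re) :
    IntegrableOn (fun t : ℝ ↦ cexp (-(z * t))) (Set.Ioi 0) := by
  simpa using integrableOn_exp_mul_complex_Ioi (a := -z) (by simpa using hz) 0

theorem integral_exp_neg_mul (hz : 0 < z.re) :
    ∫ t in Set.Ioi (0 : ℝ), cexp (-(z * t)) = z⁻¹ := by
  have := integral_exp_mul_complex_Ioi (a := -z) (by simpa using hz) 0
  simpa [neg_div] using this

end ScalarIntegrals

/-! ### The resolvent of `-Δ + κ²` as a superposition of Gaussians. -/

section Helmholtz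

variable {κ : ℂ}

/-- The complex times `e^w / κ` of the Gaussians making up the resolvent of `-Δ + κ²`. -/
def helmholtzScale (κ : ℂ) (w : ℝ) : ℂ := (Real.exp w : ℂ) / κ

/-- The weights of the Gaussians making up the resolvent of `-Δ + κ²`. -/
def helmholtzWeight (κ : ℂ) (w : ℝ) : ℂ := cexp (-(κ * Real.exp w)) * ((Real.exp w : ℂ) / κ)

theorem measurable_helmholtzScale (κ : ℂ) : Measurable (helmholtzScale κ) := by
  unfold helmholtzScale
  fun_prop

theorem helmholtzScale_re (κ : ℂ) (w : ℝ) :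
    (helmholtzScale κ w).re = Real.exp w * (κ.re / ‖κ‖ ^ 2) := by
  rw [helmholtzScale, div_eq_mul_inv, re_ofReal_mul, inv_re, normSq_eq_norm_sq]

theorem helmholtzScale_re_pos (hκ : 0 < κ.re) (w : ℝ) : 0 < (helmholtzScale κ w).re := by
  have : 0 < ‖κ‖ := norm_pos_iff.mpr (by rintro rfl; simp at hκ)
  rw [helmholtzScale_re]
  positivity

theorem norm_helmholtzScale_le (hκ : 0 < κ.re) (w : ℝ) :
    ‖helmholtzScale κ w‖ ≤ ‖κ‖ / κ.re * (helmholtzScale κ w).re := by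
  have : 0 < ‖κ‖ := norm_pos_iff.mpr (by rintro rfl; simp at hκ)
  rw [helmholtzScale_re, helmholtzScale, norm_div, norm_real, Real.norm_of_nonneg (by positivity)]
  apply le_of_eq
  field_simp

theorem integrable_helmholtzWeight (hκ : 0 < κ.re) : Integrable (helmholtzWeight κ) := by
  have h := integrable_comp_exp_iff.2 ((integrableOn_exp_neg_mul hκ).mul_const κ⁻¹)
  refine h.congr (.of_forall fun w ↦ ?_)
  simp only [helmholtzWeight, real_smul]
  ring

/-- With `u = e^w` this is `∫ e^{-(κ + l²/κ)u} du / κ`. The times run along the ray `u / κ` instead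
of the positive axis: the usual weight `e^{-κ²s}` would need `Re κ² > 0`, whereas here `Re κ > 0`
suffices. -/
theorem integral_helmholtzWeight_mul (hκ : 0 < κ.re) (l : ℝ) :
    ∫ w, helmholtzWeight κ w * cexp (-helmholtzScale κ w * l ^ 2) = (κ ^ 2 + l ^ 2)⁻¹ := by
  have hκ0 : κ ≠ 0 := by rintro rfl; simp at hκ
  have hb : 0 < (κ + l ^ 2 / κ).re := by
    have h1 : ((l : ℂ) ^ 2 / κ) = ((l ^ 2 : ℝ) : ℂ) * κ⁻¹ := by push_cast; ring
    rw [add_re, h1, re_ofReal_mul, inv_re]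
    have := normSq_nonneg κ
    positivity
  have hb0 : κ + l ^ 2 / κ ≠ 0 := by intro h; rw [h] at hb; simp at hb
  have h := integral_comp_exp (fun u ↦ cexp (-((κ + l ^ 2 / κ) * u)) * κ⁻¹)
  rw [integral_mul_const, integral_exp_neg_mul hb] at h
  have h2 : (κ ^ 2 + (l : ℂ) ^ 2)⁻¹ = (κ + l ^ 2 / κ)⁻¹ * κ⁻¹ := by
    rw [← mul_inv]; congr 1; field_simp
  rw [h2, ← h]
  congr with w
  rw [helmholtzWeight, helmholtzScale, mul_right_comm, ← exp_add, real_smul]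
  have : -(κ * (Real.exp w : ℂ)) + -((Real.exp w : ℂ) / κ) * l ^ 2 =
      -((κ + l ^ 2 / κ) * (Real.exp w : ℂ)) := by ring
  rw [this]
  ring

variable {V : Type*} [NormedAddCommGroup V] [InnerProductSpace ℝ V]

/-- Shifting `w` by `log (‖x‖ / 2)` balances the two exponents `κ e^w` and `κ ‖x‖² / (4 e^w)` into
`κ ‖x‖ cosh w`. What remains is a Macdonald integral of order `1 - n/2`: elementary for `n = 1, 3`
and of order zero for `n = 2`. -/
theorem integral_helmholtzWeight_gaussKernel (hκ : 0 < κ.re) {x : V} (hx : x ≠ 0) :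
    ∫ w, helmholtzWeight κ w * gaussKernel (helmholtzScale κ w) x =
      ‖x‖ / (2 * κ) * (2 * Real.pi * κ / ‖x‖) ^ (Module.finrank ℝ V / 2 : ℂ) *
        ∫ w : ℝ, cexp (w * (1 - Module.finrank ℝ V / 2)) * cexp (-(κ * ‖x‖ * Real.cosh w)) := by
  have hκ0 : κ ≠ 0 := by rintro rfl; simp at hκ
  have hr : 0 < ‖x‖ := norm_pos_iff.mpr hx
  have hr0 : (‖x‖ : ℂ) ≠ 0 := by exact_mod_cast hr.ne'
  rw [← integral_add_right_eq_self _ (Real.log (‖x‖ / 2)), ← integral_const_mul]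
  congr with w
  have hlog : Real.exp (w + Real.log (‖x‖ / 2)) = Real.exp w * (‖x‖ / 2) := by
    rw [Real.exp_add, Real.exp_log (by positivity)]
  have hw : (Real.exp w : ℂ) ≠ 0 := by exact_mod_cast (Real.exp_pos w).ne'
  have hneg : (Real.exp (-w) : ℂ) * Real.exp w = 1 := by
    rw [← ofReal_mul, ← Real.exp_add]; simp
  have h1 : (Real.pi : ℂ) / helmholtzScale κ (w + Real.log (‖x‖ / 2)) =
      (Real.exp (-w) : ℝ) * (2 * Real.pi * κ / ‖x‖) := by
    rw [helmholtzScale, hlog, Real.exp_neg]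
    push_cast
    field_simp
  have h2 : (2 * Real.pi * κ / ‖x‖ : ℂ) ≠ 0 := by
    have : (Real.pi : ℂ) ≠ 0 := by exact_mod_cast Real.pi_ne_zero
    exact div_ne_zero (mul_ne_zero (mul_ne_zero two_ne_zero this) hκ0) hr0
  have h3 : cexp (w * (1 - Module.finrank ℝ V / 2)) =
      Real.exp w * (Real.exp (-w) : ℂ) ^ (Module.finrank ℝ V / 2 : ℂ) := by
    rw [ofReal_exp_cpow, ofReal_exp, ← exp_add]
    congr 1
    push_cast
    ring
  have h4 : -(κ * ‖x‖ * Real.cosh w) = -(κ * (Real.exp (w + Real.log (‖x‖ / 2)) : ℝ)) +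
      -(‖x‖ ^ 2 / (4 * helmholtzScale κ (w + Real.log (‖x‖ / 2)))) := by
    rw [helmholtzScale, hlog, Real.cosh_eq, Real.exp_neg]
    push_cast
    field_simp
    ring
  rw [gaussKernel, h1, ofReal_mul_cpow (Real.exp_pos _) h2, h3, h4, exp_add, helmholtzWeight]
  have h5 : (Real.exp (w + Real.log (‖x‖ / 2)) : ℂ) = Real.exp w * (‖x‖ / 2) := by
    rw [hlog]; push_cast; ring
  rw [h5]
  ring

omit [InnerProductSpace ℝ V] in
theorem re_mul_norm_pos (hκ : 0 < κ.re) {x : V} (hx : x ≠ 0) : 0 < (κ * ‖x‖).re := by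
  rw [re_mul_ofReal]
  exact mul_pos hκ (norm_pos_iff.mpr hx)

omit [InnerProductSpace ℝ V] in
theorem cpow_half_mul_cpow_half_norm (hκ : 0 < κ.re) {x : V} (hx : x ≠ 0) :
    (2 * Real.pi * κ / ‖x‖) ^ (1 / 2 : ℂ) * (Real.pi / (2 * (κ * ‖x‖))) ^ (1 / 2 : ℂ) =
      Real.pi / ‖x‖ := by
  have hκ0 : κ ≠ 0 := by rintro rfl; simp at hκ
  have hr : 0 < ‖x‖ := norm_pos_iff.mpr hx
  have hr0 : (‖x‖ : ℂ) ≠ 0 := by exact_mod_cast hr.ne'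
  have := cpow_half_mul_cpow_half (a := 2 * Real.pi * κ / ‖x‖) (b := Real.pi / (2 * (κ * ‖x‖)))
    (c := Real.pi / ‖x‖) (by positivity) ?_ ?_
  · rw [this]; push_cast; rfl
  · have : (2 * Real.pi * κ / ‖x‖ : ℂ) = ((2 * Real.pi / ‖x‖ : ℝ) : ℂ) * κ := by push_cast; ring
    rw [this, re_ofReal_mul]
    positivity
  · push_cast
    field_simp

theorem helmholtz_kernel_one (hd : Module.finrank ℝ V = 1) (hκ : 0 < κ.re) {x : V} (hx : x ≠ 0) :
    ∫ w, helmholtzWeight κ w * gaussKernel (helmholtzScale κ w) x =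
      2 * Real.pi * (cexp (-(κ * ‖x‖)) / (2 * κ)) := by
  have hκ0 : κ ≠ 0 := by rintro rfl; simp at hκ
  have hr0 : (‖x‖ : ℂ) ≠ 0 := by simpa using hx
  have h := integral_exp_half_mul_exp (re_mul_norm_pos hκ hx)
  have h' := cpow_half_mul_cpow_half_norm hκ hx
  rw [integral_helmholtzWeight_gaussKernel hκ hx, hd]
  rw [Nat.cast_one, show (1 - 1 / 2 : ℂ) = 1 / 2 by norm_num]
  simp_rw [mul_one_div]
  rw [h]
  linear_combination (‖x‖ / (2 * κ) * 2 * cexp (-(κ * ‖x‖))) * h' +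
    (cexp (-(κ * ‖x‖)) * Real.pi / κ) * mul_inv_cancel₀ hr0

theorem helmholtz_kernel_two (hd : Module.finrank ℝ V = 2) (hκ : 0 < κ.re) {x : V} (hx : x ≠ 0) :
    ∫ w, helmholtzWeight κ w * gaussKernel (helmholtzScale κ w) x =
      Real.pi * ∫ w : ℝ, cexp (-(κ * ‖x‖ * Real.cosh w)) := by
  have hκ0 : κ ≠ 0 := by rintro rfl; simp at hκ
  have hr0 : (‖x‖ : ℂ) ≠ 0 := by simpa using hx
  rw [integral_helmholtzWeight_gaussKernel hκ hx, hd]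
  norm_num
  left
  field_simp

theorem helmholtz_kernel_three (hd : Module.finrank ℝ V = 3) (hκ : 0 < κ.re) {x : V} (hx : x ≠ 0) :
    ∫ w, helmholtzWeight κ w * gaussKernel (helmholtzScale κ w) x =
      (2 * Real.pi) ^ 3 * (cexp (-(κ * ‖x‖)) / (4 * Real.pi * ‖x‖)) := by
  have hκ0 : κ ≠ 0 := by rintro rfl; simp at hκ
  have hr0 : (‖x‖ : ℂ) ≠ 0 := by simpa using hx
  have hpi : (Real.pi : ℂ) ≠ 0 := by exact_mod_cast Real.pi_ne_zero
  have h := integral_exp_neg_half_mul_exp (re_mul_norm_pos hκ hx)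
  have h' := cpow_half_mul_cpow_half_norm hκ hx
  rw [integral_helmholtzWeight_gaussKernel hκ hx, hd]
  have h2 : (2 * Real.pi * κ / ‖x‖ : ℂ) ≠ 0 :=
    div_ne_zero (mul_ne_zero (mul_ne_zero two_ne_zero hpi) hκ0) hr0
  rw [Nat.cast_ofNat, show (1 - 3 / 2 : ℂ) = -1 / 2 by norm_num, show (3 / 2 : ℂ) = 1 + 1 / 2 by norm_num,
    cpow_add _ _ h2, cpow_one]
  simp_rw [← mul_div_assoc, mul_neg_one]
  rw [h]
  calc _ = ‖x‖ / (2 * κ) * (2 * Real.pi * κ / ‖x‖) * 2 * cexp (-(κ * ‖x‖)) *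
        ((2 * Real.pi * κ / ‖x‖) ^ (1 / 2 : ℂ) *
          (Real.pi / (2 * (κ * ‖x‖))) ^ (1 / 2 : ℂ)) := by ring
    _ = _ := by
      rw [h']
      field_simp
      ring

end Helmholtz

/-! ### The Hankel and Struve functions of order zero as integrals over a half-line or line. -/

section Hankel

variable {z : ℂ}

theorem integrableOn_exp_neg_of_le {f : ℝ → ℂ} {b : ℝ} (hb : 0 < b) (hf : Continuous f)
    (hle : ∀ t, 0 < t → (f t).re ≤ -(b * t)) :
    IntegrableOn (fun t ↦ cexp (f t)) (Set.Ioi 0) := by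
  have h := (integrableOn_exp_mul_Ioi (neg_lt_zero.2 hb) 0)
  refine Integrable.mono' h (by fun_prop) ?_
  filter_upwards [ae_restrict_mem measurableSet_Ioi] with t ht
  rw [norm_exp, Real.exp_le_exp, neg_mul]
  exact hle t ht

theorem le_cosh (t : ℝ) : t ≤ Real.cosh t := by
  rcases le_total 0 t with h | h
  · exact (Real.self_le_sinh_iff.2 h).trans (Real.sinh_lt_cosh t).le
  · exact h.trans (Real.cosh_pos t).le

theorem integrableOn_exp_neg_mul_sinh (hz : 0 < z.re) :
    IntegrableOn (fun t : ℝ ↦ cexp (-(z * Real.sinh t))) (Set.Ioi 0) := by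
  refine integrableOn_exp_neg_of_le hz (by fun_prop) fun t ht ↦ ?_
  rw [neg_re, re_mul_ofReal]
  have := Real.self_le_sinh_iff.2 ht.le
  gcongr

theorem integrableOn_exp_I_mul_cosh (hz : 0 < z.im) :
    IntegrableOn (fun t : ℝ ↦ cexp (I * z * Real.cosh t)) (Set.Ioi 0) := by
  refine integrableOn_exp_neg_of_le hz (by fun_prop) fun t ht ↦ ?_
  rw [re_mul_ofReal, I_mul_re, neg_mul]
  have := le_cosh t
  gcongr

/-- The square is `1 - 2 sin y cos y`, and the product is nonpositive in the fourth quadrant. This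
gives decay uniform in `y` on the far side of the contour below. -/
theorem one_le_cos_sub_sin {y : ℝ} (h1 : -(Real.pi / 2) ≤ y) (h2 : y ≤ 0) :
    1 ≤ Real.cos y - Real.sin y := by
  have hc := Real.cos_nonneg_of_mem_Icc (x := y) ⟨h1, by linarith [Real.pi_pos]⟩
  have hs := Real.sin_nonpos_of_nonpos_of_neg_pi_le h2 (by linarith [Real.pi_pos])
  nlinarith [Real.sin_sq_add_cos_sq y, mul_nonneg hc (neg_nonneg.2 hs)]

theorem norm_exp_neg_mul_sinh_le {T y m : ℝ} (hm0 : 0 ≤ m) (hm : m ≤ z.re) (hm' : m ≤ z.im)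
    (hT : 0 ≤ T) (h1 : -(Real.pi / 2) ≤ y) (h2 : y ≤ 0) :
    ‖cexp (-(z * Complex.sinh (T + y * I)))‖ ≤ Real.exp (-(m * T)) := by
  have hc := Real.cos_nonneg_of_mem_Icc (x := y) ⟨h1, by linarith [Real.pi_pos]⟩
  have hs := Real.sin_nonpos_of_nonpos_of_neg_pi_le h2 (by linarith [Real.pi_pos])
  have hsum := one_le_cos_sub_sin h1 h2
  have hsT : T ≤ Real.sinh T := Real.self_le_sinh_iff.2 hT
  have hcT : Real.sinh T ≤ Real.cosh T := (Real.sinh_lt_cosh T).le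
  have he : Complex.sinh (T + y * I) = (Real.sinh T * Real.cos y : ℝ) +
      (Real.cosh T * Real.sin y : ℝ) * I := by
    rw [Complex.sinh_add, cosh_mul_I, sinh_mul_I]
    push_cast
    ring
  have hre : (z * Complex.sinh (T + y * I)).re =
      z.re * (Real.sinh T * Real.cos y) - z.im * (Real.cosh T * Real.sin y) := by
    rw [he, mul_re, add_re, add_im, re_ofReal_mul, im_ofReal_mul, ofReal_re, ofReal_im, I_re, I_im]
    ring
  rw [norm_exp, Real.exp_le_exp, neg_re, neg_le_neg_iff, hre]
  have hs' : 0 ≤ -Real.sin y := neg_nonneg.2 hs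
  have hS : 0 ≤ Real.sinh T := hT.trans hsT
  calc m * T ≤ m * (T * (Real.cos y - Real.sin y)) := by
        gcongr
        exact le_mul_of_one_le_right hT hsum
    _ = m * (T * Real.cos y) + m * (T * -Real.sin y) := by ring
    _ ≤ z.re * (Real.sinh T * Real.cos y) + z.im * (Real.cosh T * -Real.sin y) := by
        have := hsT.trans hcT
        have := hm0.trans hm
        have := hm0.trans hm'
        gcongr
    _ = _ := by ring

/-- Cauchy's theorem for `e^{-z sinh w}` on the rectangle `[0, T] × [-π/2, 0]`. Since `sinh (x -
iπ/2) = -i cosh x`, the lower side carries the `cosh` integral, the upper side the `sinh` integral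
and the left side the `sin` integral. Positivity of both parts of `z` makes the right side vanish as
`T → ∞`. -/
theorem integral_exp_I_mul_cosh (hz : 0 < z.re) (hz' : 0 < z.im) :
    ∫ t in Set.Ioi (0 : ℝ), cexp (I * z * Real.cosh t) =
      I * (∫ θ in (0 : ℝ)..(Real.pi / 2), cexp (I * z * Real.sin θ)) +
        ∫ t in Set.Ioi (0 : ℝ), cexp (-(z * Real.sinh t)) := by
  set f : ℂ → ℂ := fun w ↦ cexp (-(z * Complex.sinh w)) with hf
  have hrect : ∀ T : ℝ, (∫ t in (0 : ℝ)..T, cexp (I * z * Real.cosh t)) =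
      (∫ t in (0 : ℝ)..T, cexp (-(z * Real.sinh t))) +
        I * (∫ θ in (0 : ℝ)..(Real.pi / 2), cexp (I * z * Real.sin θ)) -
        I * ∫ y in (-(Real.pi / 2))..0, f (T + y * I) := by
    intro T
    have h := integral_boundary_rect_eq_zero_of_differentiableOn f (-((Real.pi / 2 : ℝ) * I)) T
      (by fun_prop)
    have e1 : ∀ x : ℝ, f (x + (-(Real.pi / 2) : ℝ) * I) = cexp (I * z * Real.cosh x) := by
      intro x
      simp only [hf]
      rw [Complex.sinh_add, cosh_mul_I, sinh_mul_I, ← ofReal_cos, ← ofReal_sin, Real.cos_neg,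
        Real.sin_neg, Real.cos_pi_div_two, Real.sin_pi_div_two]
      push_cast
      congr 1
      ring
    have e2 : ∀ y : ℝ, f (y * I) = cexp (I * z * Real.sin (-y)) := by
      intro y
      simp only [hf]
      rw [sinh_mul_I, Real.sin_neg]
      push_cast
      congr 1
      ring
    have e3 : ∀ x : ℝ, f x = cexp (-(z * Real.sinh x)) := fun x ↦ by simp [hf]
    have r1 : (-((Real.pi / 2 : ℝ) * I) : ℂ).re = 0 := by simp
    have r2 : (-((Real.pi / 2 : ℝ) * I) : ℂ).im = -(Real.pi / 2) := by simp
    rw [r1, r2, ofReal_re, ofReal_im] at h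
    simp only [e1, ofReal_zero, zero_mul, add_zero, zero_add, e3, e2, smul_eq_mul] at h
    rw [intervalIntegral.integral_comp_neg (fun y ↦ cexp (I * z * Real.sin y))] at h
    rw [neg_zero, neg_neg] at h
    linear_combination h
  have hT := Filter.tendsto_id (α := ℝ) (x := Filter.atTop)
  have t1 := intervalIntegral_tendsto_integral_Ioi 0 (integrableOn_exp_I_mul_cosh hz') hT
  have t2 := intervalIntegral_tendsto_integral_Ioi 0 (integrableOn_exp_neg_mul_sinh hz) hT
  have t3 : Filter.Tendsto (fun T : ℝ ↦ ∫ y in (-(Real.pi / 2))..0, f (T + y * I)) Filter.atTop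
      (nhds 0) := by
    have hm : 0 < min z.re z.im := lt_min hz hz'
    have hlim : Filter.Tendsto (fun T : ℝ ↦ Real.exp (-(min z.re z.im * T)) *
        |0 - -(Real.pi / 2)|) Filter.atTop (nhds 0) := by
      have h0 := zero_mul |0 - -(Real.pi / 2)|
      nth_rw 2 [← h0]
      refine Filter.Tendsto.mul_const _ (Real.tendsto_exp_neg_atTop_nhds_zero.comp ?_)
      exact Filter.tendsto_id.const_mul_atTop hm
    refine squeeze_zero_norm' ?_ hlim
    filter_upwards [Filter.eventually_ge_atTop 0] with T hT
    refine intervalIntegral.norm_integral_le_of_norm_le_const fun y hy ↦ ?_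
    rw [Set.uIoc_of_le (by linarith [Real.pi_pos])] at hy
    exact norm_exp_neg_mul_sinh_le hm.le (min_le_left _ _) (min_le_right _ _) hT hy.1.le hy.2
  have t4 := (t2.add_const (I * ∫ θ in (0 : ℝ)..(Real.pi / 2), cexp (I * z * Real.sin θ))).sub
    (t3.const_mul I)
  simp only [id] at t1 t4
  simp_rw [← hrect] at t4
  rw [tendsto_nhds_unique t1 t4]
  ring

/-- A shift by a quarter period. This and the next two lemmas fold Bessel's and Struve's integrals
onto `[0, π/2]`, the range produced by the contour. -/
theorem intervalIntegral_comp_cos (F : ℝ → ℂ) :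
    ∫ θ in (0 : ℝ)..(2 * Real.pi), F (Real.cos θ) =
      ∫ θ in (0 : ℝ)..(2 * Real.pi), F (Real.sin θ) := by
  have hp : Function.Periodic (fun θ ↦ F (Real.sin θ)) (2 * Real.pi) := fun θ ↦ by
    simp [Real.sin_add_two_pi]
  have h := hp.intervalIntegral_add_eq (Real.pi / 2) 0
  rw [zero_add] at h
  rw [← h, add_comm (Real.pi / 2)]
  simp_rw [← Real.sin_add_pi_div_two]
  rw [intervalIntegral.integral_comp_add_right (fun θ ↦ F (Real.sin θ)), zero_add]

theorem intervalIntegral_comp_sin_two_pi {F : ℝ → ℂ} (hF : Continuous F) :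
    ∫ θ in (0 : ℝ)..(2 * Real.pi), F (Real.sin θ) =
      (∫ θ in (0 : ℝ)..Real.pi, F (Real.sin θ)) + ∫ θ in (0 : ℝ)..Real.pi, F (-Real.sin θ) := by
  have hc : Continuous (fun θ ↦ F (Real.sin θ)) := by fun_prop
  rw [← intervalIntegral.integral_add_adjacent_intervals (hc.intervalIntegrable 0 Real.pi)
    (hc.intervalIntegrable _ _)]
  congr 1
  simp_rw [← Real.sin_add_pi]
  rw [intervalIntegral.integral_comp_add_right (fun θ ↦ F (Real.sin θ)), zero_add, two_mul]

theorem intervalIntegral_comp_sin_pi {F : ℝ → ℂ} (hF : Continuous F) :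
    ∫ θ in (0 : ℝ)..Real.pi, F (Real.sin θ) =
      2 * ∫ θ in (0 : ℝ)..(Real.pi / 2), F (Real.sin θ) := by
  have hc : Continuous (fun θ ↦ F (Real.sin θ)) := by fun_prop
  rw [← intervalIntegral.integral_add_adjacent_intervals (hc.intervalIntegrable 0 (Real.pi / 2))
    (hc.intervalIntegrable _ _), two_mul]
  congr 1
  have h := intervalIntegral.integral_comp_sub_left (fun θ ↦ F (Real.sin θ)) (a := 0)
    (b := Real.pi / 2) Real.pi
  rw [sub_zero, show Real.pi - Real.pi / 2 = Real.pi / 2 by ring] at h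
  rw [← h]
  simp_rw [Real.sin_pi_sub]

theorem integral_eq_two_mul_of_even {f : ℝ → ℂ} (hf : ∀ t, f (-t) = f t)
    (hi : IntegrableOn f (Set.Ioi 0)) : ∫ t, f t = 2 * ∫ t in Set.Ioi (0 : ℝ), f t := by
  have h1 := integral_comp_neg_Ioi 0 f
  have h2 : IntegrableOn f (Set.Iic 0) := by
    have := hi.comp_neg
    simp only [hf] at this
    rw [integrableOn_Iic_iff_integrableOn_Iio]
    simpa using this
  simp only [hf, neg_zero] at h1
  rw [← intervalIntegral.integral_Iic_add_Ioi h2 hi, ← h1, two_mul]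

theorem struveK0_eq (z : ℂ) :
    struveK0 z = 2 / Real.pi * ∫ t in Set.Ioi (0 : ℝ), cexp (-(z * Real.sinh t)) := by
  rw [struveK0, struveH0, besselY0]
  ring

/-- The Hankel function as a Macdonald function. -/
theorem hankelH10_eq (hz : 0 < z.re) (hz' : 0 < z.im) :
    hankelH10 z = 1 / (Real.pi * I) * ∫ w : ℝ, cexp (I * z * Real.cosh w) := by
  have hpi : (Real.pi : ℂ) ≠ 0 := by exact_mod_cast Real.pi_ne_zero
  have hF : ∀ c : ℂ, Continuous (fun s : ℝ ↦ cexp (c * s)) := fun c ↦ by fun_prop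
  have h1 := intervalIntegral_comp_cos (fun s ↦ cexp (I * z * s))
  rw [intervalIntegral_comp_sin_two_pi (hF _)] at h1
  have h2 := intervalIntegral_comp_sin_pi (hF (I * z))
  have h3 : ∫ θ in (0 : ℝ)..Real.pi, Complex.sin (z * Real.sin θ) =
      ((∫ θ in (0 : ℝ)..Real.pi, cexp (I * z * (-Real.sin θ : ℝ))) -
        ∫ θ in (0 : ℝ)..Real.pi, cexp (I * z * (Real.sin θ : ℝ))) * (I / 2) := by
    rw [← intervalIntegral.integral_sub, ← intervalIntegral.integral_mul_const]
    · congr with θ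
      rw [Complex.sin]
      push_cast
      ring_nf
    · exact Continuous.intervalIntegrable (by fun_prop) _ _
    · exact Continuous.intervalIntegrable (by fun_prop) _ _
  have h4 := integral_eq_two_mul_of_even (f := fun t ↦ cexp (I * z * Real.cosh t))
    (fun t ↦ by rw [Real.cosh_neg]) (integrableOn_exp_I_mul_cosh hz')
  -- In `J₀ + iY₀` the integrals of `e^{-iz sin θ}` cancel, leaving those of `e^{iz sin θ}` and
  -- `e^{-z sinh t}`, exactly the right side of `integral_exp_I_mul_cosh`.
  rw [h4, integral_exp_I_mul_cosh hz hz', hankelH10, besselJ0, besselY0, h1, h3, h2]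
  field_simp
  ring_nf
  simp only [I_sq, I_pow_three]
  ring

end Hankel

/-! ### Laplace transforms of rational functions and the exponential integral. -/

section Laplace

variable {k : ℂ} {r : ℝ}

theorem integrableOn_mul_exp_neg_mul {b : ℝ} (hb : 0 < b) :
    IntegrableOn (fun t : ℝ ↦ t * Real.exp (-(b * t))) (Set.Ioi 0) := by
  have h := integrableOn_rpow_mul_exp_neg_mul_rpow (p := 1) (s := 1) (by norm_num) one_pos hb
  simpa using h

theorem norm_cexp_neg_mul (k : ℂ) (t : ℝ) : ‖cexp (-(k * t))‖ = Real.exp (-(k.re * t)) := by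
  rw [norm_exp, neg_re, re_mul_ofReal]

/-- The Laplace transform of a function of at most linear growth converges. -/
theorem integrableOn_exp_neg_mul_mul (hk : 0 < k.re) {f : ℝ → ℂ} {C : ℝ}
    (hf : AEStronglyMeasurable f (volume.restrict (Set.Ioi 0)))
    (hC : ∀ t, 0 < t → ‖f t‖ ≤ C * (1 + t)) :
    IntegrableOn (fun t : ℝ ↦ cexp (-(k * t)) * f t) (Set.Ioi 0) := by
  have h1 : IntegrableOn (fun t : ℝ ↦ Real.exp (-(k.re * t))) (Set.Ioi 0) := by
    simpa using integrableOn_exp_mul_Ioi (neg_lt_zero.2 hk) 0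
  have h2 := (h1.add (integrableOn_mul_exp_neg_mul hk)).const_mul C
  have hc : Continuous (fun t : ℝ ↦ cexp (-(k * t))) := by fun_prop
  refine Integrable.mono' h2 (hc.aestronglyMeasurable.mul hf) ?_
  filter_upwards [ae_restrict_mem measurableSet_Ioi] with t ht
  rw [norm_mul, norm_cexp_neg_mul]
  calc _ ≤ Real.exp (-(k.re * t)) * (C * (1 + t)) := by gcongr; exact hC t ht
    _ = _ := by simp only [Pi.add_apply]; ring

/-- Integration by parts in a Laplace transform. -/
theorem integral_exp_neg_mul_mul_deriv (hk : 0 < k.re) {v v' : ℝ → ℝ} {C : ℝ}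
    (hv : ∀ t, HasDerivAt v (v' t) t) (hv' : Continuous v') (hC : ∀ t, 0 < t → |v t| ≤ C)
    (hC' : ∀ t, 0 < t → |v' t| ≤ C * t) :
    ∫ t in Set.Ioi (0 : ℝ), cexp (-(k * t)) * v' t =
      -v 0 + k * ∫ t in Set.Ioi (0 : ℝ), cexp (-(k * t)) * v t := by
  have hC0 : 0 ≤ C := (abs_nonneg _).trans (hC 1 one_pos)
  have hvc : Continuous v := continuous_iff_continuousAt.2 fun t ↦ (hv t).continuousAt
  have i1 : IntegrableOn (fun t : ℝ ↦ cexp (-(k * t)) * v t) (Set.Ioi 0) := by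
    refine integrableOn_exp_neg_mul_mul hk (C := C)
      (by fun_prop : Continuous fun t ↦ (v t : ℂ)).aestronglyMeasurable fun t ht ↦ ?_
    rw [norm_real, Real.norm_eq_abs]
    nlinarith [hC t ht]
  have i2 : IntegrableOn (fun t : ℝ ↦ cexp (-(k * t)) * v' t) (Set.Ioi 0) := by
    refine integrableOn_exp_neg_mul_mul hk (C := C)
      (by fun_prop : Continuous fun t ↦ (v' t : ℂ)).aestronglyMeasurable fun t ht ↦ ?_
    rw [norm_real, Real.norm_eq_abs]
    nlinarith [hC' t ht]
  have hd : ∀ t : ℝ, HasDerivAt (fun t : ℝ ↦ cexp (-(k * t)) * v t)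
      (-k * (cexp (-(k * t)) * v t) + cexp (-(k * t)) * v' t) t := by
    intro t
    have h1 : HasDerivAt (fun t : ℝ ↦ cexp (-(k * t))) (cexp (-(k * t)) * -(k * 1)) t :=
      (((hasDerivAt_id t).ofReal_comp.const_mul k).neg).cexp
    exact (h1.fun_mul (hv t).ofReal_comp).congr_deriv (by ring)
  have hlim : Filter.Tendsto (fun t : ℝ ↦ cexp (-(k * t)) * v t) Filter.atTop (nhds 0) := by
    have hl : Filter.Tendsto (fun t : ℝ ↦ Real.exp (-(k.re * t)) * C) Filter.atTop (nhds 0) := by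
      have h0 := (Real.tendsto_exp_neg_atTop_nhds_zero.comp
        (Filter.tendsto_id.const_mul_atTop hk)).mul_const C
      rwa [zero_mul] at h0
    refine squeeze_zero_norm' ?_ hl
    filter_upwards [Filter.eventually_gt_atTop 0] with t ht
    rw [norm_mul, norm_cexp_neg_mul, norm_real, Real.norm_eq_abs]
    gcongr
    exact hC t ht
  have h := integral_Ioi_of_hasDerivAt_of_tendsto' (a := 0) (fun t _ ↦ hd t)
    ((i1.const_mul (-k)).add i2) hlim
  rw [integral_add (i1.const_mul (-k)) i2, integral_const_mul] at h
  simp only [ofReal_zero, mul_zero, neg_zero, exp_zero, one_mul] at h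
  linear_combination h

theorem abs_le_norm_ofReal_add_mul_I (t : ℝ) (ρ : ℝ) : |ρ| ≤ ‖(t : ℂ) + ρ * I‖ := by
  have := abs_im_le_norm ((t : ℂ) + ρ * I)
  simpa using this

theorem ofReal_add_mul_I_ne_zero (t : ℝ) {ρ : ℝ} (hρ : ρ ≠ 0) : (t : ℂ) + ρ * I ≠ 0 := by
  rw [← norm_pos_iff]
  exact (abs_pos.2 hρ).trans_le (abs_le_norm_ofReal_add_mul_I t ρ)

theorem integrableOn_exp_neg_mul_div (hk : 0 < k.re) {ρ : ℝ} (hρ : ρ ≠ 0) :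
    IntegrableOn (fun t : ℝ ↦ cexp (-(k * t)) / (t + ρ * I)) (Set.Ioi 0) := by
  have hm : Measurable (fun t : ℝ ↦ ((t : ℂ) + ρ * I)⁻¹) := by fun_prop
  refine integrableOn_exp_neg_mul_mul hk (C := |ρ|⁻¹) hm.aestronglyMeasurable fun t ht ↦ ?_
  rw [norm_inv]
  calc _ ≤ |ρ|⁻¹ := by
        have := abs_pos.2 hρ
        gcongr
        exact abs_le_norm_ofReal_add_mul_I t ρ
    _ ≤ _ := le_mul_of_one_le_right (by positivity) (by linarith)

/-- Holomorphy for the identity theorem in `integral_exp_neg_mul_div_eq`. Restricting to `Re z > Re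
k / 2` gives an integrable bound for the derivative that is uniform near `k`. -/
theorem differentiableOn_integral_exp_neg_mul_div {ρ : ℝ} (hρ : ρ ≠ 0) :
    DifferentiableOn ℂ (fun k : ℂ ↦ ∫ t in Set.Ioi (0 : ℝ), cexp (-(k * t)) / (t + ρ * I))
      {k | 0 < k.re} := by
  intro k hk
  have hk : 0 < k.re := hk
  refine DifferentiableAt.differentiableWithinAt ?_
  have hs : {z : ℂ | k.re / 2 < z.re} ∈ nhds k :=
    (isOpen_lt continuous_const continuous_re).mem_nhds (by simp; linarith)
  have hm : ∀ z : ℂ, Measurable (fun t : ℝ ↦ cexp (-(z * t)) / ((t : ℂ) + ρ * I)) := fun z ↦ by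
    fun_prop
  have hm' : Measurable (fun t : ℝ ↦ cexp (-(k * t)) * -(t : ℂ) / ((t : ℂ) + ρ * I)) := by fun_prop
  refine (hasDerivAt_integral_of_dominated_loc_of_deriv_le (𝕜 := ℂ)
    (F' := fun z t ↦ cexp (-(z * t)) * -(t : ℂ) / ((t : ℂ) + ρ * I))
    (bound := fun t ↦ t * Real.exp (-(k.re / 2 * t)) * |ρ|⁻¹) hs
    (.of_forall fun z ↦ (hm z).aestronglyMeasurable) (integrableOn_exp_neg_mul_div hk hρ)
    hm'.aestronglyMeasurable ?_ ((integrableOn_mul_exp_neg_mul (half_pos hk)).mul_const _)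
    ?_).2.differentiableAt
  · filter_upwards [ae_restrict_mem measurableSet_Ioi] with t ht z hz
    have ht : 0 < t := ht
    have hz : k.re / 2 < z.re := hz
    rw [norm_div, norm_mul, norm_neg, norm_cexp_neg_mul, norm_real, Real.norm_of_nonneg ht.le,
      div_eq_mul_inv, mul_comm (Real.exp _)]
    have := abs_pos.2 hρ
    gcongr
    exact abs_le_norm_ofReal_add_mul_I t ρ
  · refine .of_forall fun t z _ ↦ ?_
    have h1 : HasDerivAt (fun z : ℂ ↦ cexp (-(z * t))) (cexp (-(z * t)) * -(1 * (t : ℂ))) z :=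
      (((hasDerivAt_id z).mul_const (t : ℂ)).neg).cexp
    rw [one_mul] at h1
    exact h1.div_const _

/-- The left side is the modulus of the imaginary part, which does not involve `s`; it keeps the
denominators below away from zero. -/
theorem abs_mul_re_le (k : ℂ) (ρ s : ℝ) : |ρ| * |k.re| ≤ ‖k * (ρ * I) + s‖ := by
  have := abs_im_le_norm (k * (ρ * I) + s)
  have h : (k * (ρ * I) + s).im = ρ * k.re := by simp [mul_comm]
  rwa [h, abs_mul] at this

theorem integrableOn_exp_neg_div (hk : 0 < k.re) {ρ : ℝ} (hρ : ρ ≠ 0) :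
    IntegrableOn (fun s : ℝ ↦ cexp (-s) / (k * (ρ * I) + s)) (Set.Ioi 0) := by
  have hm : Measurable (fun s : ℝ ↦ (k * (ρ * I) + s)⁻¹) := by fun_prop
  have h := integrableOn_exp_neg_mul_mul (k := 1) (by simp) (C := (|ρ| * |k.re|)⁻¹)
    (hm.aestronglyMeasurable (μ := volume.restrict (Set.Ioi 0))) fun t ht ↦ by
      rw [norm_inv]
      have := abs_pos.2 hρ
      have := abs_pos.2 hk.ne'
      calc _ ≤ (|ρ| * |k.re|)⁻¹ := by
            gcongr
            exact abs_mul_re_le k ρ t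
        _ ≤ _ := le_mul_of_one_le_right (by positivity) (by linarith)
  simpa [div_eq_mul_inv] using h

theorem differentiableOn_integral_exp_neg_div {ρ : ℝ} (hρ : ρ ≠ 0) :
    DifferentiableOn ℂ (fun k : ℂ ↦ ∫ s in Set.Ioi (0 : ℝ), cexp (-s) / (k * (ρ * I) + s))
      {k | 0 < k.re} := by
  intro k hk
  have hk : 0 < k.re := hk
  refine DifferentiableAt.differentiableWithinAt ?_
  have hs : {z : ℂ | k.re / 2 < z.re} ∈ nhds k :=
    (isOpen_lt continuous_const continuous_re).mem_nhds (by simp; linarith)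
  have hm : ∀ z : ℂ, Measurable (fun s : ℝ ↦ cexp (-s) / (z * (ρ * I) + s)) := fun z ↦ by
    fun_prop
  have hm' : Measurable (fun s : ℝ ↦ cexp (-s) * (-(ρ * I) / (k * (ρ * I) + s) ^ 2)) := by fun_prop
  have hb : IntegrableOn (fun t : ℝ ↦ Real.exp (-t)) (Set.Ioi 0) := by
    simpa using integrableOn_exp_mul_Ioi (a := -1) (by norm_num) 0
  have hρ' := abs_pos.2 hρ
  refine (hasDerivAt_integral_of_dominated_loc_of_deriv_le (𝕜 := ℂ)
    (F' := fun z s ↦ cexp (-s) * (-(ρ * I) / (z * (ρ * I) + s) ^ 2))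
    (bound := fun t ↦ Real.exp (-t) * (|ρ| / (|ρ| * (k.re / 2)) ^ 2)) hs
    (.of_forall fun z ↦ (hm z).aestronglyMeasurable) (integrableOn_exp_neg_div hk hρ)
    hm'.aestronglyMeasurable ?_ (hb.mul_const _) ?_).2.differentiableAt
  · refine .of_forall fun t z hz ↦ ?_
    have hz : k.re / 2 < z.re := hz
    have h1 := abs_mul_re_le z ρ t
    rw [abs_of_pos (a := z.re) (by linarith)] at h1
    rw [norm_mul, norm_div, norm_pow, norm_neg, norm_mul, norm_I, mul_one, norm_exp, neg_re,
      ofReal_re, norm_real, Real.norm_eq_abs]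
    gcongr
    refine le_trans ?_ h1
    gcongr
  · refine .of_forall fun t z hz ↦ ?_
    have hz : k.re / 2 < z.re := hz
    have h1 := abs_mul_re_le z ρ t
    rw [abs_of_pos (a := z.re) (by linarith)] at h1
    have h0 : z * (ρ * I) + t ≠ 0 := by
      rw [← norm_pos_iff]
      have : 0 < z.re := by linarith
      exact lt_of_lt_of_le (by positivity) h1
    have h2 : HasDerivAt (fun z : ℂ ↦ z * (ρ * I) + t) (1 * (ρ * I)) z :=
      ((hasDerivAt_id z).mul_const (ρ * I : ℂ)).add_const _
    simp_rw [div_eq_mul_inv (cexp _)]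
    exact ((h2.fun_inv h0).const_mul (cexp (-t))).congr_deriv (by rw [one_mul])

/-- Rotation of the ray of integration in the exponential integral. -/
theorem integral_exp_neg_mul_div_eq (hk : 0 < k.re) {ρ : ℝ} (hρ : ρ ≠ 0) :
    ∫ t in Set.Ioi (0 : ℝ), cexp (-(k * t)) / (t + ρ * I) =
      ∫ s in Set.Ioi (0 : ℝ), cexp (-s) / (k * (ρ * I) + s) := by
  have hU : IsOpen {k : ℂ | 0 < k.re} := isOpen_lt continuous_const continuous_re
  have hc : IsPreconnected {k : ℂ | 0 < k.re} := (convex_halfSpace_re_gt 0).isPreconnected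
  -- On the positive axis the two rays coincide and the scaling `s = x t` suffices. These points
  -- accumulate at `1`, so the identity theorem extends the equality to the half-plane.
  have hreal : ∀ x : ℝ, 0 < x → ∫ t in Set.Ioi (0 : ℝ), cexp (-((x : ℂ) * t)) / (t + ρ * I) =
      ∫ s in Set.Ioi (0 : ℝ), cexp (-s) / ((x : ℂ) * (ρ * I) + s) := by
    intro x hx
    have h := integral_comp_mul_left_Ioi'
      (fun s : ℝ ↦ cexp (-s) / ((x : ℂ) * (ρ * I) + s)) 0 hx
    rw [mul_zero, ← integral_smul] at h
    rw [← h]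
    congr with t
    have hx' : (x : ℂ) ≠ 0 := by exact_mod_cast hx.ne'
    have := ofReal_add_mul_I_ne_zero t hρ
    rw [real_smul]
    push_cast
    rw [show (x : ℂ) * (ρ * I) + x * t = x * (t + ρ * I) by ring]
    field_simp
  have hfreq : ∃ᶠ z : ℂ in nhdsWithin 1 {1}ᶜ,
      ∫ t in Set.Ioi (0 : ℝ), cexp (-(z * t)) / (t + ρ * I) =
      ∫ s in Set.Ioi (0 : ℝ), cexp (-s) / (z * (ρ * I) + s) := by
    have ht : Filter.Tendsto (fun x : ℝ ↦ (x : ℂ)) (nhdsWithin 1 {1}ᶜ) (nhdsWithin 1 {1}ᶜ) := by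
      refine tendsto_nhdsWithin_of_tendsto_nhds_of_eventually_within _ ?_ ?_
      · have : Filter.Tendsto (fun x : ℝ ↦ (x : ℂ)) (nhds 1) (nhds ((1 : ℝ) : ℂ)) :=
          continuous_ofReal.tendsto 1
        rw [ofReal_one] at this
        exact this.mono_left nhdsWithin_le_nhds
      · filter_upwards [self_mem_nhdsWithin] with x hx
        simpa using hx
    refine ht.frequently (Filter.Eventually.frequently ?_)
    have : ∀ᶠ x : ℝ in nhds 1, 0 < x := lt_mem_nhds one_pos
    filter_upwards [nhdsWithin_le_nhds this] with x hx
    exact hreal x hx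
  exact ((differentiableOn_integral_exp_neg_mul_div hρ).analyticOnNhd hU
    ).eqOn_of_preconnected_of_frequently_eq
    ((differentiableOn_integral_exp_neg_div hρ).analyticOnNhd hU) hc (by simp) hfreq hk

theorem integral_exp_neg_mul_div (hk : 0 < k.re) {ρ : ℝ} (hρ : ρ ≠ 0) :
    ∫ t in Set.Ioi (0 : ℝ), cexp (-(k * t)) / (t + ρ * I) =
      cexp (k * (ρ * I)) * expIntegralE1 (k * (ρ * I)) := by
  rw [integral_exp_neg_mul_div_eq hk hρ, expIntegralE1, ← integral_const_mul]
  congr with s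
  rw [← mul_div_assoc, ← exp_add]
  ring_nf

/-- Abbreviation for `e^{ikr} E₁(ikr)`, the Laplace transform of `1 / (t + i r)`. -/
def expE1 (k : ℂ) (r : ℝ) : ℂ := cexp (k * (r * I)) * expIntegralE1 (k * (r * I))

/-- Partial fractions over `t ± ir`; each fraction has an `expE1` as its Laplace transform. -/
theorem integral_exp_neg_mul_poisson_one (hk : 0 < k.re) (hr : 0 < r) :
    ∫ t in Set.Ioi (0 : ℝ), cexp (-(k * t)) * (t * (t ^ 2 + r ^ 2)⁻¹ : ℝ) =
      (expE1 k r + expE1 k (-r)) / 2 := by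
  rw [expE1, expE1, ← integral_exp_neg_mul_div hk hr.ne',
    ← integral_exp_neg_mul_div hk (neg_ne_zero.2 hr.ne'),
    ← integral_add (integrableOn_exp_neg_mul_div hk hr.ne')
      (integrableOn_exp_neg_mul_div hk (neg_ne_zero.2 hr.ne')), ← integral_div]
  congr with t
  have h1 := ofReal_add_mul_I_ne_zero t hr.ne'
  have h2 := ofReal_add_mul_I_ne_zero t (neg_ne_zero.2 hr.ne')
  have h3 : ((t : ℂ) ^ 2 + r ^ 2) = (t + r * I) * (t + (-r : ℝ) * I) := by
    push_cast; ring_nf; rw [I_sq]; ring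
  push_cast at h2 h3 ⊢
  rw [neg_mul, ← sub_eq_add_neg] at h2 h3 ⊢
  rw [h3]
  field_simp
  ring

theorem integral_exp_neg_mul_inv (hk : 0 < k.re) (hr : 0 < r) :
    ∫ t in Set.Ioi (0 : ℝ), cexp (-(k * t)) * ((t ^ 2 + r ^ 2)⁻¹ : ℝ) =
      (expE1 k (-r) - expE1 k r) / (2 * I * r) := by
  have hr0 : (r : ℂ) ≠ 0 := by exact_mod_cast hr.ne'
  rw [expE1, expE1, ← integral_exp_neg_mul_div hk hr.ne',
    ← integral_exp_neg_mul_div hk (neg_ne_zero.2 hr.ne'),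
    ← integral_sub (integrableOn_exp_neg_mul_div hk (neg_ne_zero.2 hr.ne'))
      (integrableOn_exp_neg_mul_div hk hr.ne'), ← integral_div]
  congr with t
  have h1 := ofReal_add_mul_I_ne_zero t hr.ne'
  have h2 := ofReal_add_mul_I_ne_zero t (neg_ne_zero.2 hr.ne')
  have h3 : ((t : ℂ) ^ 2 + r ^ 2) = (t + r * I) * (t + (-r : ℝ) * I) := by
    push_cast; ring_nf; rw [I_sq]; ring
  push_cast at h2 h3 ⊢
  rw [neg_mul, ← sub_eq_add_neg] at h2 h3 ⊢
  rw [h3]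
  field_simp
  ring

/-- The function `t / (t² + r²)²` is the derivative of `-1 / (2(t² + r²))`, so an integration by
parts reduces to `integral_exp_neg_mul_inv`. -/
theorem integral_exp_neg_mul_poisson_three (hk : 0 < k.re) (hr : 0 < r) :
    ∫ t in Set.Ioi (0 : ℝ), cexp (-(k * t)) * (t * ((t ^ 2 + r ^ 2) ^ 2)⁻¹ : ℝ) =
      1 / (2 * r ^ 2) - k / 2 * ((expE1 k (-r) - expE1 k r) / (2 * I * r)) := by
  have hr0 : (r : ℂ) ≠ 0 := by exact_mod_cast hr.ne'
  have hpos : ∀ t : ℝ, 0 < t ^ 2 + r ^ 2 := fun t ↦ by positivity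
  have hd : ∀ t : ℝ, HasDerivAt (fun t ↦ -(t ^ 2 + r ^ 2)⁻¹ / 2) (t * ((t ^ 2 + r ^ 2) ^ 2)⁻¹) t := by
    intro t
    have h1 : HasDerivAt (fun t : ℝ ↦ t ^ 2 + r ^ 2) (2 * t) t := by
      simpa using (hasDerivAt_pow 2 t).add_const (r ^ 2)
    exact ((h1.fun_inv (hpos t).ne').fun_neg.div_const 2).congr_deriv (by ring)
  have h := integral_exp_neg_mul_mul_deriv hk (C := max (r ^ 2)⁻¹ ((r ^ 2) ^ 2)⁻¹) hd ?_ ?_ ?_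
  · rw [h, ← integral_exp_neg_mul_inv hk hr]
    have : ∀ t : ℝ, cexp (-(k * t)) * ((-(t ^ 2 + r ^ 2)⁻¹ / 2 : ℝ) : ℂ) =
        (-1 / 2) * (cexp (-(k * t)) * ((t ^ 2 + r ^ 2)⁻¹ : ℝ)) := by
      intro t; push_cast; ring
    simp_rw [this]
    rw [integral_const_mul]
    push_cast
    field_simp
    ring
  · exact continuous_id.mul (Continuous.inv₀ (by fun_prop) fun t ↦ (by positivity))
  · intro t _
    refine le_trans ?_ (le_max_left _ _)
    rw [abs_div, abs_neg, abs_of_pos (by positivity), abs_two]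
    have h2 : (t ^ 2 + r ^ 2)⁻¹ ≤ (r ^ 2)⁻¹ := by gcongr; nlinarith
    have : 0 < (t ^ 2 + r ^ 2)⁻¹ := by positivity
    linarith
  · intro t ht
    rw [abs_of_pos (by positivity), mul_comm]
    gcongr
    refine le_trans ?_ (le_max_right _ _)
    gcongr
    nlinarith

end Laplace

/-! ### The resolvent of `(-Δ)^{1/2} + k` through subordination. -/

section Poisson

variable {k : ℂ} {r : ℝ}

theorem integral_exp_neg_mul_rpow (k : ℂ) (hr : 0 < r) :
    ∫ t in Set.Ioi (0 : ℝ), cexp (-(k * t)) * ((t ^ 2 + r ^ 2) ^ (-1 / 2 : ℝ) : ℝ) =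
      ∫ u in Set.Ioi (0 : ℝ), cexp (-(k * r * Real.sinh u)) := by
  have himg : (fun u ↦ r * Real.sinh u) '' Set.Ioi 0 = Set.Ioi 0 := by
    ext y
    constructor
    · rintro ⟨u, hu, rfl⟩
      exact mul_pos hr (Real.sinh_pos_iff.2 hu)
    · intro hy
      refine ⟨Real.arsinh (y / r), Real.arsinh_pos_iff.2 (div_pos hy hr), ?_⟩
      simp only [Real.sinh_arsinh]
      field_simp
  have h := integral_image_eq_integral_abs_deriv_smul (measurableSet_Ioi (a := (0 : ℝ)))
    (fun u _ ↦ ((Real.hasDerivAt_sinh u).const_mul r).hasDerivWithinAt)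
    (fun u _ v _ huv ↦ Real.sinh_injective (mul_left_cancel₀ hr.ne' huv))
    (fun t ↦ cexp (-(k * t)) * ((t ^ 2 + r ^ 2) ^ (-1 / 2 : ℝ) : ℝ))
  rw [himg] at h
  rw [h]
  congr with u
  have hpos : 0 < r * Real.cosh u := mul_pos hr (Real.cosh_pos u)
  have h1 : ((r * Real.sinh u) ^ 2 + r ^ 2) ^ (-1 / 2 : ℝ) = (r * Real.cosh u)⁻¹ := by
    have : (r * Real.sinh u) ^ 2 + r ^ 2 = (r * Real.cosh u) ^ (2 : ℝ) := by
      rw [Real.rpow_two, mul_pow _ (Real.cosh u), Real.cosh_sq]; ring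
    rw [this, ← Real.rpow_mul hpos.le, show (2 * (-1 / 2) : ℝ) = -1 by norm_num, Real.rpow_neg_one]
  rw [h1, abs_of_pos hpos, real_smul, mul_left_comm, ← ofReal_mul, mul_inv_cancel₀ hpos.ne']
  push_cast
  rw [mul_one]
  ring_nf

/-- Integration by parts, then `t = r sinh u`; the remaining integral is the one representing the
Struve function in `struveK0_eq`. -/
theorem integral_exp_neg_mul_poisson_two (hk : 0 < k.re) (hr : 0 < r) :
    ∫ t in Set.Ioi (0 : ℝ), cexp (-(k * t)) * (t * (t ^ 2 + r ^ 2) ^ (-3 / 2 : ℝ) : ℝ) =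
      1 / r - k * ∫ u in Set.Ioi (0 : ℝ), cexp (-(k * r * Real.sinh u)) := by
  have hpos : ∀ t : ℝ, 0 < t ^ 2 + r ^ 2 := fun t ↦ by positivity
  have hle : ∀ (t : ℝ) {p : ℝ}, p ≤ 0 → (t ^ 2 + r ^ 2) ^ p ≤ (r ^ 2) ^ p := fun t p hp ↦
    Real.rpow_le_rpow_of_nonpos (by positivity) (by nlinarith) hp
  have hd : ∀ t : ℝ, HasDerivAt (fun t ↦ -(t ^ 2 + r ^ 2) ^ (-1 / 2 : ℝ))
      (t * (t ^ 2 + r ^ 2) ^ (-3 / 2 : ℝ)) t := by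
    intro t
    have h1 : HasDerivAt (fun t : ℝ ↦ t ^ 2 + r ^ 2) (2 * t) t := by
      simpa using (hasDerivAt_pow 2 t).add_const (r ^ 2)
    refine (h1.rpow_const (p := -1 / 2) (Or.inl (hpos t).ne')).fun_neg.congr_deriv ?_
    rw [show (-1 / 2 - 1 : ℝ) = -3 / 2 by norm_num]
    ring
  have h := integral_exp_neg_mul_mul_deriv hk
    (C := max ((r ^ 2) ^ (-1 / 2 : ℝ)) ((r ^ 2) ^ (-3 / 2 : ℝ))) hd ?_ ?_ ?_
  · rw [h, ← integral_exp_neg_mul_rpow k hr]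
    have h2 : (r ^ 2) ^ (-1 / 2 : ℝ) = 1 / r := by
      rw [← Real.rpow_two, ← Real.rpow_mul hr.le, show (2 * (-1 / 2) : ℝ) = -1 by norm_num,
        Real.rpow_neg_one, one_div]
    rw [zero_pow two_ne_zero, zero_add, h2]
    simp only [ofReal_neg, mul_neg, integral_neg]
    push_cast
    ring
  · exact continuous_id.mul (Continuous.rpow_const (by fun_prop) fun t ↦ Or.inl (hpos t).ne')
  · intro t _
    rw [abs_neg, abs_of_pos (Real.rpow_pos_of_pos (hpos t) _)]
    exact (hle t (by norm_num)).trans (le_max_left _ _)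
  · intro t ht
    rw [abs_of_pos (mul_pos ht (Real.rpow_pos_of_pos (hpos t) _)), mul_comm]
    gcongr
    exact (hle t (by norm_num)).trans (le_max_right _ _)

/-- Lebesgue measure on the quadrant `(0, ∞) × (0, ∞)`. -/
def quadrantMeasure : Measure (ℝ × ℝ) :=
  (volume.restrict (Set.Ioi 0)).prod (volume.restrict (Set.Ioi 0))

instance : SFinite quadrantMeasure := by unfold quadrantMeasure; infer_instance

theorem ae_quadrantMeasure_pos : ∀ᵐ α ∂quadrantMeasure, 0 < α.1 ∧ 0 < α.2 := by
  rw [quadrantMeasure, Measure.prod_restrict]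
  filter_upwards [ae_restrict_mem (measurableSet_Ioi.prod measurableSet_Ioi)] with α hα
  exact hα

section LaplaceProd

variable {q : ℝ × ℝ → ℝ} {Q : ℝ → ℝ} {C : ℝ}

/-- Tonelli: `q` is nonnegative, so its inner integral `Q` measures the mass of each slice, and
linear growth of `Q` is beaten by the exponential. -/
theorem integrable_laplace_prod (hk : 0 < k.re) (hq : Measurable q)
    (h0 : ∀ t u, 0 < t → 0 < u → 0 ≤ q (t, u))
    (hi : ∀ t, 0 < t → IntegrableOn (fun u ↦ q (t, u)) (Set.Ioi 0))
    (hQ : ∀ t, 0 < t → ∫ u in Set.Ioi (0 : ℝ), q (t, u) = Q t)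
    (hC : ∀ t, 0 < t → Q t ≤ C * (1 + t)) :
    Integrable (fun α : ℝ × ℝ ↦ cexp (-(k * α.1)) * q α) quadrantMeasure := by
  have hmeas : Measurable (fun α : ℝ × ℝ ↦ cexp (-(k * α.1)) * q α) := by fun_prop
  unfold quadrantMeasure
  rw [integrable_prod_iff hmeas.aestronglyMeasurable]
  have hb := (integrableOn_exp_neg_mul_mul hk (f := fun t ↦ ((C * (1 + t) : ℝ) : ℂ)) (C := |C|)
    (by fun_prop) fun t ht ↦ by
      rw [norm_real, norm_mul, Real.norm_eq_abs, Real.norm_of_nonneg (by linarith)]).norm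
  refine ⟨?_, hb.mono' hmeas.aestronglyMeasurable.norm.integral_prod_right' ?_⟩
  · filter_upwards [ae_restrict_mem measurableSet_Ioi] with t ht
    exact (hi t ht).ofReal.const_mul _
  · filter_upwards [ae_restrict_mem measurableSet_Ioi] with t ht
    rw [Real.norm_of_nonneg (integral_nonneg fun _ ↦ norm_nonneg _)]
    simp_rw [norm_mul]
    rw [integral_const_mul]
    gcongr
    have : ∫ u in Set.Ioi (0 : ℝ), ‖(q (t, u) : ℂ)‖ = Q t := by
      rw [← hQ t ht]
      refine setIntegral_congr_fun measurableSet_Ioi fun u hu ↦ ?_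
      simp only [norm_real]
      exact Real.norm_of_nonneg (h0 t u ht hu)
    rw [this, norm_real]
    exact (hC t ht).trans (le_abs_self _)

theorem integral_laplace_prod (hk : 0 < k.re) (hq : Measurable q)
    (h0 : ∀ t u, 0 < t → 0 < u → 0 ≤ q (t, u))
    (hi : ∀ t, 0 < t → IntegrableOn (fun u ↦ q (t, u)) (Set.Ioi 0))
    (hQ : ∀ t, 0 < t → ∫ u in Set.Ioi (0 : ℝ), q (t, u) = Q t)
    (hC : ∀ t, 0 < t → Q t ≤ C * (1 + t)) :
    ∫ α : ℝ × ℝ, cexp (-(k * α.1)) * q α ∂quadrantMeasure =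
      ∫ t in Set.Ioi (0 : ℝ), cexp (-(k * t)) * Q t := by
  have h := integrable_laplace_prod hk hq h0 hi hQ hC
  unfold quadrantMeasure at h ⊢
  rw [integral_prod _ h]
  refine setIntegral_congr_fun measurableSet_Ioi fun t ht ↦ ?_
  simp only [integral_const_mul]
  rw [integral_complex_ofReal, hQ t ht]

end LaplaceProd

/-- The density of the Gaussians of time `1 / (4 u)` in the Poisson kernel at height `t`. -/
def levyDensity (α : ℝ × ℝ) : ℝ :=
  α.1 / √Real.pi * (α.2 ^ (-1 / 2 : ℝ) * Real.exp (-(α.1 ^ 2 * α.2)))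

/-- The times of the Gaussians making up the resolvent of `(-Δ)^{1/2} + k`. -/
def poissonScale (α : ℝ × ℝ) : ℂ := ((4 * α.2)⁻¹ : ℝ)

/-- The weights of the Gaussians making up the resolvent of `(-Δ)^{1/2} + k`. -/
def poissonWeight (k : ℂ) (α : ℝ × ℝ) : ℂ := cexp (-(k * α.1)) * levyDensity α

theorem measurable_levyDensity : Measurable levyDensity := by
  unfold levyDensity
  fun_prop

theorem measurable_poissonScale : Measurable poissonScale := by
  unfold poissonScale
  fun_prop

theorem levyDensity_nonneg {t u : ℝ} (ht : 0 < t) (hu : 0 < u) : 0 ≤ levyDensity (t, u) := by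
  unfold levyDensity
  positivity

theorem poissonScale_re_pos : ∀ᵐ α ∂quadrantMeasure, 0 < (poissonScale α).re := by
  filter_upwards [ae_quadrantMeasure_pos] with α hα
  rw [poissonScale, ofReal_re]
  have := hα.2
  positivity

theorem norm_poissonScale_le : ∀ᵐ α ∂quadrantMeasure, ‖poissonScale α‖ ≤ 1 * (poissonScale α).re := by
  filter_upwards [poissonScale_re_pos] with α hα
  rw [poissonScale, ofReal_re] at hα
  rw [poissonScale, norm_real, ofReal_re, Real.norm_of_nonneg hα.le, one_mul]

/-- The two exponentials merge, leaving a Gamma integrand in `u`. For general `n` its integral is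
the Poisson kernel; for `n = 0`, `r = 0` it is the total mass of the density. -/
theorem levyDensity_mul_gauss {n : ℕ} {t u : ℝ} (hu : 0 < u) :
    levyDensity (t, u) * ((4 * Real.pi * u) ^ (n / 2 : ℝ) * Real.exp (-(r ^ 2 * u))) =
      (4 * Real.pi) ^ (n / 2 : ℝ) / √Real.pi * t *
        (u ^ ((n + 1) / 2 - 1 : ℝ) * Real.exp (-((t ^ 2 + r ^ 2) * u))) := by
  have h1 : u ^ ((n + 1) / 2 - 1 : ℝ) = u ^ (-1 / 2 : ℝ) * u ^ (n / 2 : ℝ) := by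
    rw [← Real.rpow_add hu]; ring_nf
  have h2 : -((t ^ 2 + r ^ 2) * u) = -(t ^ 2 * u) + -(r ^ 2 * u) := by ring
  rw [levyDensity, Real.mul_rpow (by positivity) hu.le, h1, h2, Real.exp_add]
  ring

theorem integrableOn_levyDensity_mul_gauss (n : ℕ) {t : ℝ} (hr : 0 < t ^ 2 + r ^ 2) :
    IntegrableOn (fun u ↦ levyDensity (t, u) *
      ((4 * Real.pi * u) ^ (n / 2 : ℝ) * Real.exp (-(r ^ 2 * u)))) (Set.Ioi 0) := by
  have h := (integrableOn_rpow_mul_exp_neg_mul_rpow (p := 1) (s := (n + 1) / 2 - 1)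
    (by have : (0 : ℝ) ≤ n := by positivity
        linarith) one_pos hr).const_mul ((4 * Real.pi) ^ (n / 2 : ℝ) / √Real.pi * t)
  refine IntegrableOn.congr_fun h (fun u hu ↦ ?_) measurableSet_Ioi
  rw [levyDensity_mul_gauss hu, Real.rpow_one, neg_mul]

theorem integral_levyDensity_mul_gauss (n : ℕ) {t : ℝ} (hr : 0 < t ^ 2 + r ^ 2) :
    ∫ u in Set.Ioi (0 : ℝ), levyDensity (t, u) *
      ((4 * Real.pi * u) ^ (n / 2 : ℝ) * Real.exp (-(r ^ 2 * u))) =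
      (4 * Real.pi) ^ (n / 2 : ℝ) / √Real.pi * Real.Gamma ((n + 1) / 2) *
        (t * (t ^ 2 + r ^ 2) ^ (-(n + 1) / 2 : ℝ)) := by
  rw [setIntegral_congr_fun measurableSet_Ioi fun u hu ↦ levyDensity_mul_gauss hu,
    integral_const_mul, Real.integral_rpow_mul_exp_neg_mul_Ioi (by positivity) hr, one_div,
    Real.inv_rpow hr.le, ← Real.rpow_neg hr.le]
  ring_nf

theorem integrableOn_levyDensity {t : ℝ} (ht : 0 < t) :
    IntegrableOn (fun u ↦ levyDensity (t, u)) (Set.Ioi 0) := by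
  simpa using integrableOn_levyDensity_mul_gauss 0 (t := t) (r := 0) (by positivity)

theorem integral_levyDensity {t : ℝ} (ht : 0 < t) :
    ∫ u in Set.Ioi (0 : ℝ), levyDensity (t, u) = 1 := by
  have h := integral_levyDensity_mul_gauss 0 (t := t) (r := 0) (by positivity)
  have h2 : (t ^ 2) ^ (-1 / 2 : ℝ) = t⁻¹ := by
    rw [← Real.rpow_two, ← Real.rpow_mul ht.le, show (2 * (-1 / 2) : ℝ) = -1 by norm_num,
      Real.rpow_neg_one]
  have : √Real.pi ≠ 0 := by positivity
  norm_num [Real.Gamma_one_half_eq] at h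
  rw [h]
  norm_num at h2
  rw [h2]
  field_simp

theorem integrable_poissonWeight (hk : 0 < k.re) : Integrable (poissonWeight k) quadrantMeasure :=
  integrable_laplace_prod (Q := fun _ ↦ 1) (C := 1) hk measurable_levyDensity
    (fun _ _ ↦ levyDensity_nonneg) (fun _ ↦ integrableOn_levyDensity)
    (fun _ ↦ integral_levyDensity) fun t ht ↦ by linarith

theorem integrableOn_levyDensity_mul_exp {t : ℝ} (ht : 0 < t) (l : ℝ) :
    IntegrableOn (fun u ↦ levyDensity (t, u) * Real.exp (-((4 * u)⁻¹ * l ^ 2))) (Set.Ioi 0) := by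
  have hm : Measurable (fun u ↦ levyDensity (t, u) * Real.exp (-((4 * u)⁻¹ * l ^ 2))) :=
    (measurable_levyDensity.comp measurable_prodMk_left).mul (by fun_prop)
  refine (integrableOn_levyDensity ht).mono' hm.aestronglyMeasurable ?_
  filter_upwards [ae_restrict_mem measurableSet_Ioi] with u hu
  have hu : 0 < u := hu
  have h0 := levyDensity_nonneg ht hu
  rw [Real.norm_of_nonneg (by positivity)]
  exact mul_le_of_le_one_right h0 (Real.exp_le_one_iff.2 (neg_nonpos.2 (by positivity)))

/-- Subordination: the exponential is a superposition of Gaussians. -/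
theorem integral_levyDensity_mul_exp {t l : ℝ} (ht : 0 < t) (hl : 0 < l) :
    ∫ u in Set.Ioi (0 : ℝ), levyDensity (t, u) * Real.exp (-((4 * u)⁻¹ * l ^ 2)) =
      Real.exp (-(t * l)) := by
  have hz : 0 < ((t * l : ℝ) : ℂ).re := by rw [ofReal_re]; positivity
  have hcore := integral_exp_half_mul_exp hz
  -- Shifting by `log s` balances `t² u` against `l² / (4u)`: their sum becomes `t l cosh w`.
  set s : ℝ := l / (2 * t) with hs
  have hs0 : 0 < s := by positivity
  have hexp : ∀ w : ℝ, Real.exp (w + Real.log s) = Real.exp w * s := fun w ↦ by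
    rw [Real.exp_add, Real.exp_log hs0]
  have h := integral_comp_exp fun u ↦
    ((levyDensity (t, u) * Real.exp (-((4 * u)⁻¹ * l ^ 2)) : ℝ) : ℂ)
  rw [← integral_add_right_eq_self _ (Real.log s)] at h
  have hpt : ∀ w : ℝ, Real.exp (w + Real.log s) •
      ((levyDensity (t, Real.exp (w + Real.log s)) *
        Real.exp (-((4 * Real.exp (w + Real.log s))⁻¹ * l ^ 2)) : ℝ) : ℂ) =
      ((t / √Real.pi * √s : ℝ) : ℂ) * (cexp (w / 2) * cexp (-((t * l : ℝ) * Real.cosh w))) := by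
    intro w
    have e1 : cexp (w / 2) = (Real.exp (w / 2) : ℝ) := by push_cast; rfl
    have e2 : cexp (-((t * l : ℝ) * Real.cosh w)) = (Real.exp (-(t * l * Real.cosh w)) : ℝ) := by
      push_cast; rfl
    rw [e1, e2, real_smul, ← ofReal_mul, ← ofReal_mul, ← ofReal_mul, hexp, levyDensity]
    congr 1
    have e3 : (Real.exp w * s) ^ (-1 / 2 : ℝ) * (Real.exp w * s) = Real.exp (w / 2) * √s := by
      rw [← Real.rpow_add_one (by positivity), Real.mul_rpow (by positivity) hs0.le,
        Real.sqrt_eq_rpow, ← Real.exp_mul, show (-1 / 2 + 1 : ℝ) = 1 / 2 by norm_num,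
        mul_one_div]
    have e4 : -(t * l * Real.cosh w) =
        -(t ^ 2 * (Real.exp w * s)) + -((4 * (Real.exp w * s))⁻¹ * l ^ 2) := by
      rw [Real.cosh_eq, Real.exp_neg, hs]
      field_simp
      ring
    rw [e4, Real.exp_add]
    linear_combination (t / √Real.pi * Real.exp (-(t ^ 2 * (Real.exp w * s))) *
      Real.exp (-((4 * (Real.exp w * s))⁻¹ * l ^ 2))) * e3
  simp_rw [hpt] at h
  rw [integral_const_mul, hcore, integral_complex_ofReal] at h
  have hsq : ((Real.pi : ℂ) / (2 * (t * l : ℝ))) ^ (1 / 2 : ℂ) = (√(Real.pi / (2 * (t * l))) : ℝ) := by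
    rw [Real.sqrt_eq_rpow, ofReal_cpow (by positivity)]
    push_cast
    rfl
  have hval : t / √Real.pi * √s * (2 * √(Real.pi / (2 * (t * l)))) = 1 := by
    have e5 : √s * √(Real.pi / (2 * (t * l))) = √Real.pi / (2 * t) := by
      rw [← Real.sqrt_mul hs0.le, hs,
        show l / (2 * t) * (Real.pi / (2 * (t * l))) = Real.pi / (2 * t) ^ 2 by field_simp,
        Real.sqrt_div Real.pi_pos.le, Real.sqrt_sq (by positivity)]
    have : √Real.pi ≠ 0 := by positivity
    calc _ = t / √Real.pi * 2 * (√s * √(Real.pi / (2 * (t * l)))) := by ring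
      _ = _ := by rw [e5]; field_simp
  rw [hsq] at h
  have e6 : cexp (-((t * l : ℝ) : ℂ)) = (Real.exp (-(t * l)) : ℝ) := by push_cast; rfl
  rw [e6] at h
  have h' : Real.exp (-(t * l)) = ∫ u in Set.Ioi (0 : ℝ),
      levyDensity (t, u) * Real.exp (-((4 * u)⁻¹ * l ^ 2)) := by
    rw [← mul_one (Real.exp _), ← hval, ← ofReal_inj, ← h]
    push_cast
    ring
  exact h'.symm

theorem integral_poissonWeight_mul (hk : 0 < k.re) {l : ℝ} (hl : 0 < l) :
    ∫ α, poissonWeight k α * cexp (-poissonScale α * l ^ 2) ∂quadrantMeasure = (k + l)⁻¹ := by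
  have h := integral_laplace_prod
    (q := fun α ↦ levyDensity α * Real.exp (-((4 * α.2)⁻¹ * l ^ 2)))
    (Q := fun t ↦ Real.exp (-(t * l))) (C := 1) hk
    (measurable_levyDensity.mul (by fun_prop))
    (fun t u ht hu ↦ mul_nonneg (levyDensity_nonneg ht hu) (Real.exp_pos _).le)
    (fun t ht ↦ integrableOn_levyDensity_mul_exp ht l)
    (fun t ht ↦ integral_levyDensity_mul_exp ht hl)
    fun t ht ↦ by
      have : Real.exp (-(t * l)) ≤ 1 := Real.exp_le_one_iff.2 (neg_nonpos.2 (by positivity))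
      linarith
  have hkl : 0 < (k + l).re := by rw [add_re, ofReal_re]; positivity
  rw [← integral_exp_neg_mul hkl]
  refine Eq.trans ?_ (h.trans ?_)
  · congr with α
    rw [poissonWeight, poissonScale]
    push_cast
    ring_nf
  · congr with t
    push_cast
    rw [← exp_add]
    ring_nf

variable {V : Type*} [NormedAddCommGroup V] [InnerProductSpace ℝ V]

theorem gaussKernel_poissonScale {α : ℝ × ℝ} (hα : 0 < α.2) (x : V) :
    gaussKernel (poissonScale α) x =
      (((4 * Real.pi * α.2) ^ (Module.finrank ℝ V / 2 : ℝ) * Real.exp (-(‖x‖ ^ 2 * α.2)) : ℝ) : ℂ) := by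
  have h1 : (Real.pi : ℂ) / poissonScale α = ((4 * Real.pi * α.2 : ℝ) : ℂ) := by
    rw [poissonScale]; push_cast; rw [div_inv_eq_mul]; ring
  have h2 : -((‖x‖ : ℂ) ^ 2 / (4 * poissonScale α)) = ((-(‖x‖ ^ 2 * α.2) : ℝ) : ℂ) := by
    have : (α.2 : ℂ) ≠ 0 := by exact_mod_cast hα.ne'
    rw [poissonScale]; push_cast; field_simp
  have h3 : ((4 * Real.pi * α.2 : ℝ) : ℂ) ^ (Module.finrank ℝ V / 2 : ℂ) =
      (((4 * Real.pi * α.2) ^ (Module.finrank ℝ V / 2 : ℝ) : ℝ) : ℂ) := by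
    rw [ofReal_cpow (by positivity)]
    push_cast
    rfl
  rw [gaussKernel, h1, h2, h3, ← ofReal_exp, ← ofReal_mul]

/-- Integrating out `u` turns the Gaussians into a multiple of the Poisson kernel at height `t`. The
bound required on `Q` is linear because the power of `t² + ‖x‖²` is at most its value at `t = 0`. -/
theorem integral_poissonWeight_gaussKernel (hk : 0 < k.re) {x : V} (hx : x ≠ 0) :
    ∫ α, poissonWeight k α * gaussKernel (poissonScale α) x ∂quadrantMeasure =
      ((4 * Real.pi) ^ (Module.finrank ℝ V / 2 : ℝ) / √Real.pi *
          Real.Gamma ((Module.finrank ℝ V + 1) / 2) : ℝ) *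
        ∫ t in Set.Ioi (0 : ℝ), cexp (-(k * t)) *
          (t * (t ^ 2 + ‖x‖ ^ 2) ^ (-(Module.finrank ℝ V + 1) / 2 : ℝ) : ℝ) := by
  set n := Module.finrank ℝ V
  have hr : 0 < ‖x‖ := norm_pos_iff.2 hx
  set c : ℝ := (4 * Real.pi) ^ (n / 2 : ℝ) / √Real.pi * Real.Gamma ((n + 1) / 2) with hc
  have hc0 : 0 < c := by
    have : 0 < Real.Gamma (((n : ℝ) + 1) / 2) := Real.Gamma_pos_of_pos (by positivity)
    positivity
  have hn : (-(n + 1) / 2 : ℝ) ≤ 0 := by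
    have : (0 : ℝ) ≤ n := by positivity
    linarith
  have h := integral_laplace_prod
    (q := fun α ↦ levyDensity α *
      ((4 * Real.pi * α.2) ^ (n / 2 : ℝ) * Real.exp (-(‖x‖ ^ 2 * α.2))))
    (Q := fun t ↦ c * (t * (t ^ 2 + ‖x‖ ^ 2) ^ (-(n + 1) / 2 : ℝ)))
    (C := c * (‖x‖ ^ 2) ^ (-(n + 1) / 2 : ℝ)) hk
    (measurable_levyDensity.mul (by fun_prop))
    (fun t u ht hu ↦ mul_nonneg (levyDensity_nonneg ht hu) (by positivity))
    (fun t ht ↦ integrableOn_levyDensity_mul_gauss n (by positivity))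
    (fun t ht ↦ integral_levyDensity_mul_gauss n (by positivity))
    fun t ht ↦ by
      have : (t ^ 2 + ‖x‖ ^ 2) ^ (-(n + 1) / 2 : ℝ) ≤ (‖x‖ ^ 2) ^ (-(n + 1) / 2 : ℝ) :=
        Real.rpow_le_rpow_of_nonpos (by positivity) (by nlinarith) hn
      have ht1 : t ≤ 1 + t := by linarith
      rw [mul_comm t, mul_assoc c]
      exact mul_le_mul_of_nonneg_left (mul_le_mul this ht1 ht.le (by positivity)) hc0.le
  rw [← integral_const_mul]
  refine Eq.trans (integral_congr_ae ?_) (h.trans ?_)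
  · filter_upwards [ae_quadrantMeasure_pos] with α hα
    rw [gaussKernel_poissonScale hα.2, poissonWeight]
    push_cast
    ring
  · congr with t
    push_cast
    ring

end Poisson

/-! ### The outgoing Green's function and the sign of its quadratic form. -/

section Green

variable {V : Type*} [NormedAddCommGroup V] [InnerProductSpace ℝ V] {k : ℂ}

/-- The Gaussian superposition representing `(2π)^d` times the outgoing Green's function, according
to `1 / (λ - k) = 1 / (λ + k) + 2 k / (λ² - k²)`. -/
def greenSuperposition (k : ℂ) (x : V) : ℂ :=
  ∫ α, poissonWeight k α * gaussKernel (poissonScale α) x ∂quadrantMeasure +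
    2 * k * ∫ w, helmholtzWeight (-(I * k)) w * gaussKernel (helmholtzScale (-(I * k)) w) x

/-- The choice `κ = -ik` turns `κ² + λ²` into `λ² - k²` and `e^{-κr}` into `e^{ikr}`; `Im k > 0` is
what makes the Helmholtz superposition converge. -/
theorem neg_I_mul_re (k : ℂ) : (-(I * k)).re = k.im := by simp

theorem greenSuperposition_one (hd : Module.finrank ℝ V = 1) (hk : 0 < k.re) (hk' : 0 < k.im)
    {x : V} (hx : x ≠ 0) :
    greenSuperposition k x = (2 * Real.pi) * outgoingGreenRadial 1 k ‖x‖ := by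
  have hr : 0 < ‖x‖ := norm_pos_iff.2 hx
  have hk0 : k ≠ 0 := by rintro rfl; simp at hk
  have hpi : (Real.pi : ℂ) ≠ 0 := by exact_mod_cast Real.pi_ne_zero
  have hκ : 0 < (-(I * k)).re := by rwa [neg_I_mul_re]
  have hc : (4 * Real.pi) ^ ((1 : ℕ) / 2 : ℝ) / √Real.pi *
      Real.Gamma (((1 : ℕ) + 1) / 2) = 2 := by
    have : √Real.pi ≠ 0 := by positivity
    rw [Nat.cast_one, ← Real.sqrt_eq_rpow, Real.sqrt_mul (by norm_num), one_add_one_eq_two,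
      div_self two_ne_zero, Real.Gamma_one, show (4 : ℝ) = 2 ^ 2 by norm_num,
      Real.sqrt_sq (by norm_num)]
    field_simp
  have hp : ∀ t : ℝ, t * (t ^ 2 + ‖x‖ ^ 2) ^ (-((1 : ℕ) + 1) / 2 : ℝ) = t * (t ^ 2 + ‖x‖ ^ 2)⁻¹ := by
    intro t
    rw [Nat.cast_one, show (-(1 + 1) / 2 : ℝ) = -1 by norm_num, Real.rpow_neg_one]
  rw [greenSuperposition, integral_poissonWeight_gaussKernel hk hx, helmholtz_kernel_one hd hκ hx,
    hd, hc]
  simp_rw [hp]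
  rw [integral_exp_neg_mul_poisson_one hk hr, outgoingGreenRadial, expE1, expE1]
  push_cast
  rw [show k * (‖x‖ * I) = I * k * ‖x‖ by ring, show k * (-‖x‖ * I) = -(I * k * ‖x‖) by ring,
    show -(-(I * k) * ‖x‖) = I * k * ‖x‖ by ring]
  field_simp
  ring_nf
  simp only [I_sq]
  ring

theorem greenSuperposition_two (hd : Module.finrank ℝ V = 2) (hk : 0 < k.re) (hk' : 0 < k.im)
    {x : V} (hx : x ≠ 0) :
    greenSuperposition k x = (2 * Real.pi) ^ 2 * outgoingGreenRadial 2 k ‖x‖ := by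
  have hr : 0 < ‖x‖ := norm_pos_iff.2 hx
  have hr0 : (‖x‖ : ℂ) ≠ 0 := by exact_mod_cast hr.ne'
  have hk0 : k ≠ 0 := by rintro rfl; simp at hk
  have hpi : (Real.pi : ℂ) ≠ 0 := by exact_mod_cast Real.pi_ne_zero
  have hκ : 0 < (-(I * k)).re := by rwa [neg_I_mul_re]
  have hc : (4 * Real.pi) ^ ((2 : ℕ) / 2 : ℝ) / √Real.pi *
      Real.Gamma (((2 : ℕ) + 1) / 2) = 2 * Real.pi := by
    have : √Real.pi ≠ 0 := by positivity
    rw [Nat.cast_two, div_self two_ne_zero, Real.rpow_one,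
      show ((2 + 1) / 2 : ℝ) = 1 / 2 + 1 by norm_num, Real.Gamma_add_one (by norm_num),
      Real.Gamma_one_half_eq]
    field_simp
    ring
  have hp : ∀ t : ℝ, t * (t ^ 2 + ‖x‖ ^ 2) ^ (-((2 : ℕ) + 1) / 2 : ℝ) =
      t * (t ^ 2 + ‖x‖ ^ 2) ^ (-3 / 2 : ℝ) := by
    intro t
    norm_num
  rw [greenSuperposition, integral_poissonWeight_gaussKernel hk hx, helmholtz_kernel_two hd hκ hx,
    hd, hc]
  simp_rw [hp]
  have hz : 0 < (k * ‖x‖).re := by rw [re_mul_ofReal]; positivity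
  have hz' : 0 < (k * ‖x‖).im := by rw [im_mul_ofReal]; positivity
  rw [integral_exp_neg_mul_poisson_two hk hr, outgoingGreenRadial, struveK0_eq, hankelH10_eq hz hz']
  have he : ∀ w : ℝ, -(-(I * k) * ‖x‖ * Real.cosh w) = I * (k * ‖x‖) * Real.cosh w := fun w ↦ by ring
  simp_rw [he]
  push_cast
  field_simp
  ring

theorem greenSuperposition_three (hd : Module.finrank ℝ V = 3) (hk : 0 < k.re) (hk' : 0 < k.im)
    {x : V} (hx : x ≠ 0) :
    greenSuperposition k x = (2 * Real.pi) ^ 3 * outgoingGreenRadial 3 k ‖x‖ := by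
  have hr : 0 < ‖x‖ := norm_pos_iff.2 hx
  have hr0 : (‖x‖ : ℂ) ≠ 0 := by exact_mod_cast hr.ne'
  have hk0 : k ≠ 0 := by rintro rfl; simp at hk
  have hpi : (Real.pi : ℂ) ≠ 0 := by exact_mod_cast Real.pi_ne_zero
  have hκ : 0 < (-(I * k)).re := by rwa [neg_I_mul_re]
  have hc : (4 * Real.pi) ^ ((3 : ℕ) / 2 : ℝ) / √Real.pi *
      Real.Gamma (((3 : ℕ) + 1) / 2) = 8 * Real.pi := by
    have : √Real.pi ≠ 0 := by positivity
    rw [Nat.cast_ofNat, show (3 / 2 : ℝ) = 1 + 1 / 2 by norm_num, Real.rpow_add (by positivity),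
      Real.rpow_one, ← Real.sqrt_eq_rpow, Real.sqrt_mul (by norm_num),
      show ((3 + 1) / 2 : ℝ) = 1 + 1 by norm_num, Real.Gamma_add_one one_ne_zero, Real.Gamma_one,
      show √(4 : ℝ) = 2 by rw [show (4 : ℝ) = 2 ^ 2 by norm_num, Real.sqrt_sq (by norm_num)]]
    field_simp
    ring
  have hp : ∀ t : ℝ, t * (t ^ 2 + ‖x‖ ^ 2) ^ (-((3 : ℕ) + 1) / 2 : ℝ) =
      t * ((t ^ 2 + ‖x‖ ^ 2) ^ 2)⁻¹ := by
    intro t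
    rw [Nat.cast_ofNat, show (-(3 + 1) / 2 : ℝ) = -(2 : ℕ) by norm_num,
      Real.rpow_neg (by positivity), Real.rpow_natCast]
  rw [greenSuperposition, integral_poissonWeight_gaussKernel hk hx, helmholtz_kernel_three hd hκ hx,
    hd, hc]
  simp_rw [hp]
  rw [integral_exp_neg_mul_poisson_three hk hr, outgoingGreenRadial, expE1, expE1]
  push_cast
  rw [show k * (‖x‖ * I) = I * k * ‖x‖ by ring, show k * (-‖x‖ * I) = -(I * k * ‖x‖) by ring,
    show -(-(I * k) * ‖x‖) = I * k * ‖x‖ by ring]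
  field_simp
  ring_nf
  simp only [I_sq]
  ring

theorem greenSuperposition_eq {d : ℕ} (hd : d = 1 ∨ d = 2 ∨ d = 3) (hk : 0 < k.re) (hk' : 0 < k.im)
    {x : EuclideanSpace ℝ (Fin d)} (hx : x ≠ 0) :
    greenSuperposition k x = ((2 * Real.pi) ^ d : ℝ) * outgoingGreen d k x := by
  have hf := finrank_euclideanSpace_fin (𝕜 := ℝ) (n := d)
  push_cast
  rcases hd with rfl | rfl | rfl
  · rw [greenSuperposition_one hf hk hk' hx, pow_one]; rfl
  · rw [greenSuperposition_two hf hk hk' hx]; rfl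
  · rw [greenSuperposition_three hf hk hk' hx]; rfl

variable [FiniteDimensional ℝ V] [MeasurableSpace V] [BorelSpace V]

theorem integrable_greenSuperposition (hk : 0 < k.re) (hk' : 0 < k.im) :
    Integrable (greenSuperposition k : V → ℂ) := by
  have hκ : 0 < (-(I * k)).re := by rwa [neg_I_mul_re]
  exact (integrable_superposition (integrable_poissonWeight hk) measurable_poissonScale
    poissonScale_re_pos norm_poissonScale_le).integral_prod_right.add
    ((integrable_superposition (integrable_helmholtzWeight hκ) (measurable_helmholtzScale _)
      (.of_forall (helmholtzScale_re_pos hκ)) (.of_forall (norm_helmholtzScale_le hκ))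
      ).integral_prod_right.const_mul _)

/-- The symbol `1 / (λ - k)` of the outgoing Green's function has nonnegative imaginary part. -/
theorem inv_add_two_mul_inv_im_nonneg (hk : 0 < k.re) (hk' : 0 < k.im) {l : ℝ} (hl : 0 < l) :
    0 ≤ ((k + l)⁻¹ + 2 * k * ((-(I * k)) ^ 2 + l ^ 2)⁻¹).im := by
  have h1 : k + l ≠ 0 := fun h ↦ by
    have := congr_arg re h
    simp at this
    linarith
  have h2 : l - k ≠ 0 := fun h ↦ by
    have := congr_arg im h
    simp at this
    linarith
  have h3 : (-(I * k)) ^ 2 + (l : ℂ) ^ 2 = (l - k) * (k + l) := by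
    rw [neg_sq, mul_pow, I_sq]; ring
  have h4 : (k + l)⁻¹ + 2 * k * ((-(I * k)) ^ 2 + l ^ 2)⁻¹ = (l - k)⁻¹ := by
    rw [h3]
    field_simp
    ring
  rw [h4, inv_im]
  have := normSq_nonneg (l - k)
  simp only [sub_im, ofReal_im, zero_sub, neg_neg]
  positivity

theorem integral_quadIntegrand_green_im_nonneg [Nontrivial V] (hk : 0 < k.re) (hk' : 0 < k.im)
    {φ : V → ℂ} (hφ : Integrable φ) (hφ2 : MemLp φ 2) :
    0 ≤ (∫ p, quadIntegrand (greenSuperposition k) φ p ∂(volume.prod volume)).im := by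
  have hκ : 0 < (-(I * k)).re := by rwa [neg_I_mul_re]
  have hP := integrable_superposition (V := V) (integrable_poissonWeight hk) measurable_poissonScale
    poissonScale_re_pos norm_poissonScale_le
  have hH := integrable_superposition (V := V) (integrable_helmholtzWeight hκ)
    (measurable_helmholtzScale _)
    (.of_forall (helmholtzScale_re_pos hκ)) (.of_forall (norm_helmholtzScale_le hκ))
  have hP' := integrable_superposition_fourier (V := V) (integrable_poissonWeight hk)
    measurable_poissonScale poissonScale_re_pos hφ hφ2
  have hH' := integrable_superposition_fourier (V := V) (integrable_helmholtzWeight hκ)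
    (measurable_helmholtzScale _) (.of_forall (helmholtzScale_re_pos hκ)) hφ hφ2
  have iP := hP'.integral_prod_right
  have iH := hH'.integral_prod_right.const_mul (2 * k)
  simp only [← mul_assoc, integral_mul_const] at iP iH
  have hsum : ∀ p : V × V, quadIntegrand (greenSuperposition k) φ p =
      quadIntegrand (fun x ↦ ∫ α, poissonWeight k α * gaussKernel (poissonScale α) x
        ∂quadrantMeasure) φ p +
      2 * k * quadIntegrand (fun x ↦ ∫ w, helmholtzWeight (-(I * k)) w *
        gaussKernel (helmholtzScale (-(I * k)) w) x) φ p := by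
    intro p
    simp only [quadIntegrand, greenSuperposition]
    ring
  simp_rw [hsum]
  rw [integral_add (integrable_quadIntegrand hP.integral_prod_right hφ2)
    ((integrable_quadIntegrand hH.integral_prod_right hφ2).const_mul _), integral_const_mul,
    integral_quadIntegrand_superposition (integrable_poissonWeight hk) measurable_poissonScale
      poissonScale_re_pos norm_poissonScale_le hφ hφ2,
    integral_quadIntegrand_superposition (integrable_helmholtzWeight hκ)
      (measurable_helmholtzScale _) (.of_forall (helmholtzScale_re_pos hκ))
      (.of_forall (norm_helmholtzScale_le hκ)) hφ hφ2,
    ← integral_const_mul]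
  simp only [← mul_assoc]
  rw [← integral_add iP iH]
  have him := integral_im (𝕜 := ℂ) (iP.add iH)
  simp only [RCLike.im_to_complex, Pi.add_apply] at him
  rw [← him]
  refine integral_nonneg_of_ae ?_
  -- Subordination is available only for `λ = ‖ξ‖ > 0`; in a nontrivial space the origin is null.
  have hne : ∀ᵐ ξ : V, ξ ≠ 0 := by simp [ae_iff]
  filter_upwards [hne] with ξ hξ
  have hl : 0 < ‖ξ‖ := norm_pos_iff.2 hξ
  rw [integral_poissonWeight_mul hk hl, integral_helmholtzWeight_mul hκ, ← add_mul]
  have := inv_add_two_mul_inv_im_nonneg hk hk' hl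
  rw [← ofReal_pow ‖fourierInt φ ξ‖, im_mul_ofReal]
  simp only [Pi.zero_apply]
  positivity

end Green

/-! ### Testing the resonance equation. -/

section Resonance

/-- The resonance equation tested against its solution, extended by zero outside `D`. -/
theorem resonanceOp_pairing {d : ℕ} (hd : d = 1 ∨ d = 2 ∨ d = 3) {c g ρ₀ Ω : ℝ}
    {D : Set (EuclideanSpace ℝ (Fin d))} (hD : MeasurableSet D) {ω : ℂ} (hk : 0 < (ω / c).re)
    (hk' : 0 < (ω / c).im) {ψ : EuclideanSpace ℝ (Fin d) → ℂ}
    (hψ : MemLp (D.indicator ψ) 2)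
    (hres : resonanceOp d c g ρ₀ Ω D ω ψ =ᵐ[volume.restrict D] 0) :
    (ω - Ω) * (∫ x, ‖D.indicator ψ x‖ ^ 2 : ℝ) + (g ^ 2 * ρ₀ / c / (2 * Real.pi) ^ d : ℝ) *
      ∫ p, quadIntegrand (greenSuperposition (ω / c)) (D.indicator ψ) p ∂(volume.prod volume) = 0 := by
  have : Nonempty (Fin d) := ⟨⟨0, by omega⟩⟩
  set φ := D.indicator ψ with hφ
  have hQ := integrable_quadIntegrand (integrable_greenSuperposition hk hk') hψ
  have hN := hψ.integrable_norm_pow (p := 2) (by norm_num)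
  rw [integral_prod _ hQ, ← integral_complex_ofReal, ← integral_const_mul, ← integral_const_mul,
    ← integral_add]
  · refine integral_eq_zero_of_ae ?_
    rw [Filter.EventuallyEq, ae_restrict_iff' hD] at hres
    filter_upwards [hres] with x hx
    simp only [Pi.zero_apply] at hx ⊢
    by_cases hxD : x ∈ D
    · have hx := hx hxD
      have hφx : φ x = ψ x := Set.indicator_of_mem hxD ψ
      have hpow : (((2 * Real.pi) ^ d : ℝ) : ℂ) ≠ 0 := by
        have : (2 * Real.pi) ^ d ≠ 0 := by positivity
        exact_mod_cast this
      have h1 : ∫ y, quadIntegrand (greenSuperposition (ω / c)) φ (x, y) =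
          ((2 * Real.pi) ^ d : ℝ) * (∫ y in D, outgoingGreen d (ω / c) (x - y) * ψ y) *
            conj (φ x) := by
        rw [← integral_indicator hD, ← integral_const_mul, ← integral_mul_const]
        refine integral_congr_ae ?_
        -- The explicit formula for the kernel holds off the diagonal only, which is a null set for
        -- each fixed `x`.
        have hne : ∀ᵐ y : EuclideanSpace ℝ (Fin d), y ≠ x := by simp [ae_iff]
        filter_upwards [hne] with y hy
        rw [quadIntegrand, greenSuperposition_eq hd hk hk' (sub_ne_zero.2 hy.symm)]
        have : D.indicator (fun y ↦ outgoingGreen d (ω / c) (x - y) * ψ y) y =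
            outgoingGreen d (ω / c) (x - y) * φ y := by
          by_cases hyD : y ∈ D <;> simp [hφ, hyD]
        rw [this]
        ring
      rw [resonanceOp] at hx
      rw [h1, ofReal_div, ofReal_pow, ← mul_conj', hφx]
      rw [show ((g ^ 2 * ρ₀ / c : ℝ) : ℂ) / ((2 * Real.pi) ^ d : ℝ) *
        (((2 * Real.pi) ^ d : ℝ) * (∫ y in D, outgoingGreen d (ω / c) (x - y) * ψ y) *
            conj (ψ x)) = (g ^ 2 * ρ₀ / c : ℝ) *
            (∫ y in D, outgoingGreen d (ω / c) (x - y) * ψ y) * conj (ψ x) by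
        field_simp]
      -- The sign undoes the two minus signs in the definition of `resonanceOp`.
      linear_combination (-conj (ψ x)) * hx
    · have hφx : φ x = 0 := Set.indicator_of_notMem hxD ψ
      simp [quadIntegrand, hφx]
  · exact hN.ofReal.const_mul _
  · exact hQ.integral_prod_left.const_mul _

end Resonance

end

end QuantumOptics

/-! ### Conclusion: comparing imaginary parts. -/

theorem proposition3p2 (d : ℕ) (hd : d = 1 ∨ d = 2 ∨ d = 3)
    (c g ρ₀ Ω : ℝ) (hc : 0 < c) (hρ₀ : 0 ≤ ρ₀)
    (D : Set (EuclideanSpace ℝ (Fin d)))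
    (hDo : IsOpen D) (hDc : IsConnected D) (hDb : Bornology.IsBounded D)
    (ω : ℂ) (hω : 0 < ω.re)
    (ψ : Lp ℂ 2 (volume.restrict D)) (hψ : ψ ≠ 0)
    (hres : QuantumOptics.resonanceOp d c g ρ₀ Ω D ω ψ =ᵐ[volume.restrict D] 0) :
    ω.im ≤ 0 := by
  by_contra! him
  have hk : 0 < (ω / c).re := by rw [Complex.div_ofReal_re]; positivity
  have hk' : 0 < (ω / c).im := by rw [Complex.div_ofReal_im]; positivity
  have : Nonempty (Fin d) := ⟨⟨0, by omega⟩⟩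
  have hD := hDo.measurableSet
  have : IsFiniteMeasure (volume.restrict D) := ⟨by
    rw [Measure.restrict_apply_univ]; exact hDb.measure_lt_top⟩
  have hφ2 : MemLp (D.indicator ψ) 2 := (memLp_indicator_iff_restrict hD).2 (Lp.memLp ψ)
  -- Boundedness of `D` puts `L²(D)` inside `L¹`, so that the Fourier integral of the extension by
  -- zero converges pointwise.
  have hφ : Integrable (D.indicator ψ) :=
    (integrable_indicator_iff hD).2 ((Lp.memLp ψ).integrable one_le_two)
  have hpair := QuantumOptics.resonanceOp_pairing hd hD hk hk' hφ2 hres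
  have hpos := QuantumOptics.integral_quadIntegrand_green_im_nonneg hk hk' hφ hφ2
  have hN : 0 < ∫ x, ‖D.indicator ψ x‖ ^ 2 := by
    have hint := hφ2.integrable_norm_pow (p := 2) (by norm_num)
    refine lt_of_le_of_ne (integral_nonneg fun _ ↦ by positivity) fun h ↦ hψ ?_
    have h0 := (integral_eq_zero_iff_of_nonneg (fun _ ↦ by positivity) hint).1 h.symm
    rw [Lp.eq_zero_iff_ae_eq_zero, Filter.EventuallyEq, ae_restrict_iff' hD]
    filter_upwards [h0] with x hx hxD
    simpa [hxD] using hx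
  -- The real shift `Ω` drops out of the imaginary part, leaving a positive term plus a nonnegative
  -- one equal to zero.
  have h := congr_arg Complex.im hpair
  rw [Complex.add_im, Complex.im_mul_ofReal, Complex.im_ofReal_mul, Complex.zero_im,
    Complex.sub_im, Complex.ofReal_im, sub_zero] at h
  have h1 : 0 < ω.im * ∫ x, ‖D.indicator ψ x‖ ^ 2 := mul_pos him hN
  have h2 : 0 ≤ g ^ 2 * ρ₀ / c / (2 * Real.pi) ^ d := by positivity
  have h3 := mul_nonneg h2 hpos
  linarith
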